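/- Let $\mathbf H^3=\mathbb C\times(0,\infty)$ be hyperbolic $3$-space, $I$ its full isometry group, and $\mathbf S=\mathbb C\cup\{\infty\}$ its ideal boundary, on which $I$ acts by continuous extension. A *nice lattice* is a subgroup $\Gamma\subset I$ acting freely, properly discontinuously and cocompactly on $\mathbf H^3$ (so that $\mathbf H^3/\Gamma$ is a compact hyperbolic manifold). An *equivariant pair* $(H,h)$ consists of a bi-Lipschitz bijection $H:\mathbf H^3\to\mathbf H^3$ and a homeomorphism $h:\mathbf S\to\mathbf S$ extending $H$ continuously, such that for some nice lattices $\Gamma_1,\Gamma_2$ both $H\Gamma_1H^{-1}=\Gamma_2$ and $h\Gamma_1h^{-1}=\Gamma_2$. Write $(H,h)\sim(H',h')$ if there are $f,g\in I$ with $H'=fHg$ and $h'=fhg$. Pairs are normalized so that $h(\infty)=\infty$; then $h$ is also regarded as a homeomorphism of $\mathbb C$. For $z\in\mathbb C$ the *zoom sequence* based on $(h,z)$ is $(H_n,h_n)=(f_nHg_n,\,f_nhg_n)$, $n\ge 1$, where $f_n$ is the homothety fixing $h(z)$ with factor $n$ and $g_n$ is the homothety fixing $z$ with factor $1/n$. Write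 $h\to h'$ (with $H,H'$ understood) if for some $z\in\mathbb C$ the zoom sequence based on $(h,z)$ is tame, i.e. $\{H_n(p)\}$ is bounded for each $p\in\mathbf H^3$, and on a subsequence $H_n\to H'$ uniformly on compact subsets of $\mathbf H^3$ and $h_n\to h'$ uniformly on $\mathbf S$. A line $L\subset\mathbb C$ is *good* for $h$ if $h|_L$ is affine, i.e. $h(L)$ is a line and $h$ scales lengths on $L$ by a constant positive factor. **Corollary.** Let $(H,h)$ be an equivariant pair with $h(\infty)=\infty$, and let $D$ be a direction in $\mathbb C$. Then there are equivariant pairs $(H',h')$ and $(H'',h'')$, with $h'(\infty)=h''(\infty)=\infty$ and both equivalent ($\sim$) to $(H,h)$, such that $h\to h'\to h''$ and every line in $\mathbb C$ of direction $D$ is good for $h''$. -/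

import Mathlib

open Set Filter Topology

/-- Points `(z, t)`, `t > 0`, of the upper half space model of hyperbolic 3-space. -/
@[ext]
structure HypThree where
  z : ℂ
  t : ℝ
  pos : 0 < t

namespace HypThree

/-- The point as a point of the Euclidean space `ℂ × ℝ` (with the Euclidean norm). -/
def toEuclid (p : HypThree) : WithLp 2 (ℂ × ℝ) := WithLp.toLp 2 (p.z, p.t)

/-- The Euclidean reflection `(z, -t)` of the point. -/
def toEuclidRefl (p : HypThree) : WithLp 2 (ℂ × ℝ) := WithLp.toLp 2 (p.z, -p.t)

/-- The hyperbolic distance (curvature `-1`):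
`sinh (d / 2) = |p - q| / (2 √(t_p t_q))`, with `|p - q|` the Euclidean distance. -/
noncomputable instance : Dist HypThree :=
  ⟨fun p q => 2 * Real.arsinh (dist p.toEuclid q.toEuclid / (2 * √(p.t * q.t)))⟩

theorem dist_def (p q : HypThree) :
    dist p q = 2 * Real.arsinh (dist p.toEuclid q.toEuclid / (2 * √(p.t * q.t))) := rfl

theorem sq_dist_toEuclid (p q : HypThree) :
    dist p.toEuclid q.toEuclid ^ 2 = ‖p.z - q.z‖ ^ 2 + (p.t - q.t) ^ 2 := by
  rw [dist_eq_norm, WithLp.prod_norm_sq_eq_of_L2]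
  simp [toEuclid]

theorem sq_dist_toEuclidRefl (p q : HypThree) :
    dist p.toEuclid q.toEuclidRefl ^ 2 = ‖p.z - q.z‖ ^ 2 + (p.t + q.t) ^ 2 := by
  rw [dist_eq_norm, WithLp.prod_norm_sq_eq_of_L2]
  simp [toEuclid, toEuclidRefl]

theorem sinh_half_dist (p q : HypThree) :
    Real.sinh (dist p q / 2) = dist p.toEuclid q.toEuclid / (2 * √(p.t * q.t)) := by
  rw [dist_def, mul_div_cancel_left₀ _ (two_ne_zero' ℝ), Real.sinh_arsinh]

theorem cosh_half_dist (p q : HypThree) :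
    Real.cosh (dist p q / 2) = dist p.toEuclid q.toEuclidRefl / (2 * √(p.t * q.t)) := by
  have hp := p.pos
  have hq := q.pos
  have h0 : 0 < p.t * q.t := mul_pos hp hq
  rw [← sq_eq_sq₀ (Real.cosh_pos _).le (by positivity), Real.cosh_sq, sinh_half_dist, div_pow,
    div_pow, sq_dist_toEuclid, sq_dist_toEuclidRefl, mul_pow, Real.sq_sqrt h0.le]
  field_simp
  ring

theorem dist_refl_comm (p q : HypThree) :
    dist p.toEuclid q.toEuclidRefl = dist q.toEuclid p.toEuclidRefl := by
  rw [← sq_eq_sq₀ dist_nonneg dist_nonneg, sq_dist_toEuclidRefl, sq_dist_toEuclidRefl,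
    norm_sub_rev, add_comm p.t]

theorem dist_self_refl (p : HypThree) : dist p.toEuclid p.toEuclidRefl = 2 * p.t := by
  have hp := p.pos
  rw [← sq_eq_sq₀ dist_nonneg (by positivity), sq_dist_toEuclidRefl]
  simp
  ring

theorem dist_triangle' (a b c : HypThree) : dist a c ≤ dist a b + dist b c := by
  have ha := a.pos
  have hb := b.pos
  have hc := c.pos
  rw [← div_le_div_iff_of_pos_right (zero_lt_two' ℝ), ← Real.sinh_le_sinh, add_div,
    Real.sinh_add, sinh_half_dist, sinh_half_dist, sinh_half_dist, cosh_half_dist,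
    cosh_half_dist, dist_refl_comm b c]
  have key := EuclideanGeometry.mul_dist_le_mul_dist_add_mul_dist
    a.toEuclid b.toEuclid c.toEuclid b.toEuclidRefl
  rw [dist_self_refl] at key
  rw [Real.sqrt_mul ha.le, Real.sqrt_mul ha.le, Real.sqrt_mul hb.le]
  have h1 := Real.sqrt_pos.2 ha
  have h2 := Real.sqrt_pos.2 hb
  have h3 := Real.sqrt_pos.2 hc
  have h4 : √b.t ^ 2 = b.t := Real.sq_sqrt hb.le
  have e : dist a.toEuclid b.toEuclid / (2 * (√a.t * √b.t)) *
        (dist c.toEuclid b.toEuclidRefl / (2 * (√b.t * √c.t))) +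
      dist a.toEuclid b.toEuclidRefl / (2 * (√a.t * √b.t)) *
        (dist b.toEuclid c.toEuclid / (2 * (√b.t * √c.t))) =
      (dist a.toEuclid b.toEuclid * dist c.toEuclid b.toEuclidRefl +
        dist b.toEuclid c.toEuclid * dist a.toEuclid b.toEuclidRefl) /
        (4 * (√a.t * √c.t) * b.t) := by
    have h6 : 4 * (√a.t * √c.t) * b.t = 4 * (√a.t * √c.t) * √b.t ^ 2 := by rw [h4]
    rw [h6]
    field_simp
    ring
  rw [e, div_le_div_iff₀ (by positivity) (by positivity)]
  have h5 : 0 < 2 * (√a.t * √c.t) := by positivity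
  nlinarith [mul_le_mul_of_nonneg_right key h5.le]

theorem eq_of_dist_eq_zero' {p q : HypThree} (h : dist p q = 0) : p = q := by
  have hp := p.pos
  have hq := q.pos
  have h1 := sinh_half_dist p q
  rw [h, zero_div, Real.sinh_zero, eq_comm, div_eq_zero_iff] at h1
  have h2 : 0 < 2 * √(p.t * q.t) := by positivity
  have h3 : p.toEuclid = q.toEuclid := dist_eq_zero.1 (h1.resolve_right h2.ne')
  have h4 : (p.z, p.t) = (q.z, q.t) := WithLp.toLp_injective 2 h3
  exact HypThree.ext (congrArg Prod.fst h4) (congrArg Prod.snd h4)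

noncomputable instance : MetricSpace HypThree where
  dist_self p := by simp [dist_def]
  dist_comm p q := by rw [dist_def, dist_def, dist_comm p.toEuclid, mul_comm p.t]
  dist_triangle := dist_triangle'
  eq_of_dist_eq_zero := eq_of_dist_eq_zero'

/-- The homothety with centre `c ∈ ℂ` and factor `r > 0`, acting on hyperbolic space. -/
noncomputable def homothety (c : ℂ) (r : ℝ) (hr : 0 < r) (p : HypThree) : HypThree :=
  ⟨AffineMap.homothety c r p.z, r * p.t, mul_pos hr p.pos⟩

/-- Hyperbolic space inside the one-point compactification of `ℂ × ℝ`. -/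
def toBall (p : HypThree) : OnePoint (ℂ × ℝ) := ((p.z, p.t) : ℂ × ℝ)

end HypThree

/-- The Riemann sphere `ℂ ∪ {∞}`. -/
abbrev RSphere : Type := OnePoint ℂ

/-- The Riemann sphere as the ideal boundary of the upper half space, inside the one-point
compactification of `ℂ × ℝ`. -/
def RSphere.toBall : RSphere → OnePoint (ℂ × ℝ) := OnePoint.map fun z => (z, 0)

/-- The homeomorphism `h` of the sphere is the continuous extension of the map `H` of hyperbolic
space: whenever `p` tends to the ideal point `ξ`, `H p` tends to `h ξ`. -/
def IsBoundaryExtension (H : HypThree → HypThree) (h : RSphere ≃ₜ RSphere) : Prop :=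
  ∀ ξ : RSphere, Tendsto (fun p => (H p).toBall) (comap HypThree.toBall (𝓝 ξ.toBall))
    (𝓝 (h ξ).toBall)

/-- Bi-Lipschitz bijections of hyperbolic space. -/
def IsBL (H : Equiv.Perm HypThree) : Prop :=
  ∃ K : ℝ, 1 ≤ K ∧ ∀ p q, K⁻¹ * dist p q ≤ dist (H p) (H q) ∧ dist (H p) (H q) ≤ K * dist p q

/-- Nice lattices: groups of isometries of hyperbolic space that act freely, properly
discontinuously and cocompactly, i.e. the deck groups of compact hyperbolic 3-manifolds. -/
structure IsNiceLattice (Γ : Subgroup (HypThree ≃ᵢ HypThree)) : Prop where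
  free : ∀ g ∈ Γ, ∀ p, g p = p → g = 1
  discontinuous : ∀ K : Set HypThree, IsCompact K → {g | g ∈ Γ ∧ (g '' K ∩ K).Nonempty}.Finite
  cocompact : ∃ K : Set HypThree, IsCompact K ∧ ∀ p, ∃ g ∈ Γ, g p ∈ K

/-- The group `Γ` acting on the sphere: the set of boundary extensions of its elements. -/
def boundaryAction (Γ : Subgroup (HypThree ≃ᵢ HypThree)) : Set (RSphere ≃ₜ RSphere) :=
  {φ | ∃ g ∈ Γ, IsBoundaryExtension g φ}

/-- `(H, h)` is an equivariant pair: `H` is bi-Lipschitz, `h` is its continuous extension to the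
sphere, and `H Γ₁ H⁻¹ = Γ₂`, `h Γ₁ h⁻¹ = Γ₂` for one and the same pair of nice lattices. -/
def IsEquivariantPair (H : Equiv.Perm HypThree) (h : RSphere ≃ₜ RSphere) : Prop :=
  IsBL H ∧ IsBoundaryExtension H h ∧
    ∃ Γ₁ Γ₂ : Subgroup (HypThree ≃ᵢ HypThree), IsNiceLattice Γ₁ ∧ IsNiceLattice Γ₂ ∧
      (fun g : HypThree ≃ᵢ HypThree => H * g.toEquiv * H⁻¹) '' (Γ₁ : Set (HypThree ≃ᵢ HypThree))
        = IsometryEquiv.toEquiv '' (Γ₂ : Set (HypThree ≃ᵢ HypThree)) ∧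
      (fun φ : RSphere ≃ₜ RSphere => h * φ * h⁻¹) '' boundaryAction Γ₁ = boundaryAction Γ₂

/-- `(H, h) ∼ (H', h')`: there are isometries `f`, `g` with `H' = f H g` and `h' = f h g`, where
in the second equation `f`, `g` act on the sphere. -/
def PairEquivalent (H : Equiv.Perm HypThree) (h : RSphere ≃ₜ RSphere)
    (H' : Equiv.Perm HypThree) (h' : RSphere ≃ₜ RSphere) : Prop :=
  ∃ (f g : HypThree ≃ᵢ HypThree) (φ ψ : RSphere ≃ₜ RSphere),
    IsBoundaryExtension f φ ∧ IsBoundaryExtension g ψ ∧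
      (∀ p, H' p = f (H (g p))) ∧ ∀ ξ, h' ξ = φ (h (ψ ξ))

/-- The maps `f_m H g_m`, `m = n + 1 ≥ 1`, of the zoom sequence based on `(h, z)`: `f_m` is the
homothety fixing `h z` with factor `m`, and `g_m` the homothety fixing `z` with factor `1 / m`. -/
noncomputable def zoomHyp (H : Equiv.Perm HypThree) (h : ℂ ≃ₜ ℂ) (z : ℂ) (n : ℕ)
    (p : HypThree) : HypThree :=
  HypThree.homothety (h z) (n + 1) n.cast_add_one_pos
    (H (HypThree.homothety z (1 / (n + 1)) (one_div_pos.2 n.cast_add_one_pos) p))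

/-- The maps `f_m h g_m`, `m = n + 1 ≥ 1`, of the zoom sequence based on `(h, z)`, on `ℂ`. -/
noncomputable def zoomPlane (h : ℂ ≃ₜ ℂ) (z : ℂ) (n : ℕ) (u : ℂ) : ℂ :=
  AffineMap.homothety (h z) ((n : ℝ) + 1) (h (AffineMap.homothety z (1 / ((n : ℝ) + 1)) u))

/-- A sequence of maps of hyperbolic space is tame if the images of each point are bounded. -/
def IsTame (F : ℕ → HypThree → HypThree) : Prop :=
  ∀ p, Bornology.IsBounded (range fun n => F n p)

/-- Uniform convergence on the sphere, for its unique compatible uniform structure. -/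
def SphereTendstoUniformly (F : ℕ → RSphere → RSphere) (f : RSphere → RSphere) : Prop :=
  letI : UniformSpace RSphere := uniformSpaceOfCompactR1
  TendstoUniformly F f atTop

/-- `h → h'` (with `H`, `H'` in the background): for some base point `z`, the zoom sequence
`(H_n, h_n)` based on `(h, z)` is tame, and on a subsequence `H_n` converges to `H'` uniformly on
compact sets and `h_n` converges to `h'` uniformly on the sphere.  The homeomorphisms `h`, `h'` of
`ℂ` stand for homeomorphisms of the sphere that fix `∞`. -/
def ZoomsTo (H : Equiv.Perm HypThree) (h : ℂ ≃ₜ ℂ) (H' : Equiv.Perm HypThree) (h' : ℂ ≃ₜ ℂ) :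
    Prop :=
  ∃ z : ℂ, IsTame (zoomHyp H h z) ∧ ∃ s : ℕ → ℕ, StrictMono s ∧
    (∀ K : Set HypThree, IsCompact K →
      TendstoUniformlyOn (fun k => zoomHyp H h z (s k)) H' atTop K) ∧
    SphereTendstoUniformly (fun k => OnePoint.map (zoomPlane h z (s k))) h'.onePointCongr

/-- The line through `p` with direction `v`. -/
def planeLine (p v : ℂ) : Set ℂ := {x | ∃ s : ℝ, x = p + s * v}

/-- Straight lines in `ℂ`. -/
def IsPlaneLine (L : Set ℂ) : Prop := ∃ p v : ℂ, v ≠ 0 ∧ L = planeLine p v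

/-- The set `L` (a line) is good for `h`: `h` restricts to an affine map on `L`, i.e. `h(L)` is a
line and `h` scales lengths on `L` by a constant factor. -/
def IsGoodLine (h : ℂ → ℂ) (L : Set ℂ) : Prop :=
  IsPlaneLine (h '' L) ∧ ∃ c : ℝ, 0 < c ∧ ∀ x ∈ L, ∀ y ∈ L, dist (h x) (h y) = c * dist x y

/-- The direction of `v ≠ 0` is good for `h`: every line of this direction is good for `h`. -/
def IsGoodDirection (h : ℂ → ℂ) (v : ℂ) : Prop := ∀ p : ℂ, IsGoodLine h (planeLine p v)

/-! The lattices provide compactness, and length-area estimates provide a point at which to zoom.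

Compactness: for every isometry `g`, cocompactness of the first lattice and equivariance give `H g =
c H a`, where `c` is an isometry and `a` is one of bounded displacement
(`IsEquivariantPair.exists_renormalization`). A tame sequence `f_n H g_n` becomes `(f_n c_n) H a_n`
with both outer factors in a sequentially compact set of isometries, so it subconverges to some `b H
a`, which is equivalent to `H`, and the same holds on the sphere
(`IsEquivariantPair.exists_subseq_tendsto`). For tameness of a zoom it is enough that the rescaled
maps have a nonzero limit displacement in one direction, because then the images of three ideal
points stay apart (`IsEquivariantPair.isTame`). Renormalizing similarities and comparing cross
ratios shows that `h` is quasisymmetric (`IsEquivariantPair.quasisymmetric`).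

Analysis: let `k` be quasisymmetric and let `μ` be the area of the image under `k`. The squared
displacement of `k` along a side of a square is at most a constant times the `μ`-mass of the square.
Cauchy-Schwarz then makes `k` absolutely continuous on unit segments of almost every horizontal line
in the upper half plane. If a nonzero horizontal derivative existed only on a null set, `k` would be
constant on such a segment, against injectivity (`volume_nonzero_horizontal_deriv_ne_zero`). At a
suitable density point of the set of nonzero derivative, nearby horizontal difference quotients are
close to one vector `w` (`exists_density_point`). Zooming in there spreads these nearby points over
the whole plane, so the limit moves by `s * w` along every line of the direction.

Thus one zoom already makes the direction good, and the corollary follows by zooming twice.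
Isometries are treated throughout as Lorentz transformations, which makes their limits and their
boundary action linear algebra. -/

/-! ### Isometries as Lorentz transformations of the hyperboloid. -/

/-- Minkowski space, with coordinates adapted to the upper half space model. -/
abbrev Mink : Type := ℝ × ℂ × ℝ

/-- The Lorentz form `(a c' + c a') / 2 - Re (z conj z')`. -/
noncomputable def mform : Mink →ₗ[ℝ] Mink →ₗ[ℝ] ℝ :=
  LinearMap.mk₂ ℝ (fun x y => (x.1 * y.2.2 + x.2.2 * y.1) / 2 -
      (x.2.1.re * y.2.1.re + x.2.1.im * y.2.1.im))
    (fun x x' y => by simp; ring) (fun c x y => by simp; ring)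
    (fun x y y' => by simp; ring) (fun c x y => by simp; ring)

theorem mform_apply (x y : Mink) : mform x y = (x.1 * y.2.2 + x.2.2 * y.1) / 2 -
    (x.2.1.re * y.2.1.re + x.2.1.im * y.2.1.im) := rfl

theorem mform_comm (x y : Mink) : mform x y = mform y x := by
  simp only [mform_apply]; ring

theorem continuous_mform : Continuous fun p : Mink × Mink => mform p.1 p.2 := by
  simp only [mform_apply]
  have h1 : Continuous fun p : Mink × Mink => p.1.2.1.re :=
    Complex.continuous_re.comp (by fun_prop)
  have h2 : Continuous fun p : Mink × Mink => p.2.2.1.re :=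
    Complex.continuous_re.comp (by fun_prop)
  have h3 : Continuous fun p : Mink × Mink => p.1.2.1.im :=
    Complex.continuous_im.comp (by fun_prop)
  have h4 : Continuous fun p : Mink × Mink => p.2.2.1.im :=
    Complex.continuous_im.comp (by fun_prop)
  fun_prop

/-- The Lorentz form is nondegenerate. -/
theorem eq_zero_of_mform_eq_zero {x : Mink} (h : ∀ y, mform x y = 0) : x = 0 := by
  have h1 := h (1, 0, 0)
  have h2 := h (0, 0, 1)
  have h3 := h (0, 1, 0)
  have h4 := h (0, Complex.I, 0)
  simp [mform_apply] at h1 h2 h3 h4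
  exact Prod.ext h2 (Prod.ext (Complex.ext h3 h4) h1)

/-- The linear height function on the light cone. -/
noncomputable def mtrace : Mink →L[ℝ] ℝ :=
  ContinuousLinearMap.fst ℝ ℝ (ℂ × ℝ) +
    (ContinuousLinearMap.snd ℝ ℂ ℝ).comp (ContinuousLinearMap.snd ℝ ℝ (ℂ × ℝ))

@[simp] theorem mtrace_apply (x : Mink) : mtrace x = x.1 + x.2.2 := rfl

namespace HypThree

/-- The hyperboloid model. -/
noncomputable def hyperboloid (p : HypThree) : Mink :=
  (1 / p.t, (1 / p.t : ℝ) • p.z, (‖p.z‖ ^ 2 + p.t ^ 2) / p.t)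

theorem norm_sq_eq (z : ℂ) : ‖z‖ ^ 2 = z.re ^ 2 + z.im ^ 2 := by
  rw [Complex.sq_norm, Complex.normSq_apply]; ring

theorem mform_hyperboloid (p q : HypThree) :
    mform p.hyperboloid q.hyperboloid = Real.cosh (dist p q) := by
  have hp := p.pos
  have hq := q.pos
  have h0 : 0 < p.t * q.t := mul_pos hp hq
  have e : dist p q = 2 * (dist p q / 2) := by ring
  rw [e, Real.cosh_two_mul, Real.cosh_sq, sinh_half_dist, div_pow, mul_pow, Real.sq_sqrt h0.le,
    sq_dist_toEuclid]
  simp only [mform_apply, hyperboloid, norm_sq_eq]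
  simp
  field_simp
  ring

theorem dist_eq_iff_mform {p q p' q' : HypThree} : dist p q = dist p' q' ↔
    mform p.hyperboloid q.hyperboloid = mform p'.hyperboloid q'.hyperboloid := by
  rw [mform_hyperboloid, mform_hyperboloid]
  refine ⟨fun h => by rw [h], fun h => ?_⟩
  exact Real.cosh_injOn dist_nonneg dist_nonneg h

theorem hyperboloid_injective : Function.Injective hyperboloid := by
  intro p q h
  rw [← dist_eq_zero, ← dist_self p, dist_eq_iff_mform, h]

theorem mform_hyperboloid_self (p : HypThree) : mform p.hyperboloid p.hyperboloid = 1 := by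
  rw [mform_hyperboloid, dist_self, Real.cosh_zero]

/-- The hyperboloid is a sheet of the unit quadric. -/
theorem exists_hyperboloid_eq {x : Mink} (h : mform x x = 1) (h0 : 0 ≤ x.1) :
    ∃ p : HypThree, p.hyperboloid = x := by
  obtain ⟨a, z, c⟩ := x
  simp only [mform_apply] at h h0
  have ha : 0 < a := by
    rcases h0.lt_or_eq with h1 | h1
    · exact h1
    · rw [← h1] at h
      nlinarith [sq_nonneg z.re, sq_nonneg z.im]
  refine ⟨⟨(1 / a : ℝ) • z, 1 / a, by positivity⟩, ?_⟩
  have hz : ‖(1 / a : ℝ) • z‖ ^ 2 = (z.re ^ 2 + z.im ^ 2) / a ^ 2 := by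
    rw [norm_smul, mul_pow, norm_sq_eq, Real.norm_of_nonneg (by positivity)]
    field_simp
  simp only [hyperboloid, hz]
  refine Prod.ext (by simp) (Prod.ext ?_ ?_)
  · simp only [smul_smul]
    rw [show 1 / (1 / a) * (1 / a) = 1 by field_simp, one_smul]
  · have : c = (1 + z.re ^ 2 + z.im ^ 2) / a := by
      field_simp
      linarith
    simp only [this]
    field_simp
    ring

/-- The base point `(0, 1)`. -/
def base : HypThree := ⟨0, 1, one_pos⟩

theorem mtrace_eq_mform (x : Mink) : mtrace x = 2 * mform x base.hyperboloid := by
  simp [mform_apply, hyperboloid, base]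
  ring

theorem mtrace_hyperboloid_pos (p : HypThree) : 0 < mtrace p.hyperboloid := by
  rw [mtrace_eq_mform, mform_hyperboloid]
  have := Real.cosh_pos (dist p base)
  positivity

/-- Four points whose images in the hyperboloid model form a basis. -/
noncomputable def frame : Fin 4 → HypThree :=
  ![⟨0, 1, one_pos⟩, ⟨1, 1, one_pos⟩, ⟨Complex.I, 1, one_pos⟩, ⟨0, 2, two_pos⟩]

/-- The coordinates with respect to `frame`. -/
noncomputable def coord (i : Fin 4) : Mink →L[ℝ] ℝ :=
  let a : Mink →L[ℝ] ℝ := ContinuousLinearMap.fst ℝ ℝ (ℂ × ℝ)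
  let z : Mink →L[ℝ] ℂ :=
    (ContinuousLinearMap.fst ℝ ℂ ℝ).comp (ContinuousLinearMap.snd ℝ ℝ (ℂ × ℝ))
  let c : Mink →L[ℝ] ℝ :=
    (ContinuousLinearMap.snd ℝ ℂ ℝ).comp (ContinuousLinearMap.snd ℝ ℝ (ℂ × ℝ))
  let x := Complex.reCLM.comp z
  let y := Complex.imCLM.comp z
  ![a - x - y - (1 / 3 : ℝ) • (c - a - x - y), x, y, (2 / 3 : ℝ) • (c - a - x - y)] i

theorem sum_coord_smul (x : Mink) : ∑ i, coord i x • (frame i).hyperboloid = x := by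
  obtain ⟨a, z, c⟩ := x
  simp only [Fin.sum_univ_four]
  refine Prod.ext ?_ (Prod.ext (Complex.ext ?_ ?_) ?_) <;>
  simp [coord, frame, hyperboloid] <;> ring

/-- The linear map of Minkowski space that extends a map of the hyperboloid. -/
noncomputable def linearize (a : HypThree → HypThree) : Mink →L[ℝ] Mink :=
  ∑ i, (coord i).smulRight (a (frame i)).hyperboloid

theorem linearize_apply (a : HypThree → HypThree) (x : Mink) :
    linearize a x = ∑ i, coord i x • (a (frame i)).hyperboloid := by
  simp [linearize]

/-- Only the Gram matrix of `frame` matters; its entries are `cosh` of distances, so an isometry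
preserves them. -/
theorem mform_linearize {a : HypThree → HypThree} (ha : Isometry a) (x y : Mink) :
    mform (linearize a x) (linearize a y) = mform x y := by
  conv_rhs => rw [← sum_coord_smul x, ← sum_coord_smul y]
  simp only [linearize_apply, map_sum, map_smul, LinearMap.sum_apply, LinearMap.smul_apply]
  refine Finset.sum_congr rfl fun i _ => ?_
  congr 1
  refine Finset.sum_congr rfl fun j _ => ?_
  rw [dist_eq_iff_mform.1 (ha.dist_eq (frame j) (frame i))]

theorem linearize_surjective {a : HypThree → HypThree} (ha : Isometry a) :
    Function.Surjective (linearize a) := by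
  have : Function.Injective (linearize a : Mink →ₗ[ℝ] Mink) := by
    rw [← LinearMap.ker_eq_bot, LinearMap.ker_eq_bot']
    intro x hx
    refine eq_zero_of_mform_eq_zero fun y => ?_
    rw [← mform_linearize ha]
    erw [hx]
    simp
  exact LinearMap.surjective_of_injective this

/-- The difference of the two sides is orthogonal to the images of the frame vectors. These images
span, by surjectivity, and the form is nondegenerate. -/
theorem linearize_hyperboloid {a : HypThree → HypThree} (ha : Isometry a) (p : HypThree) :
    linearize a p.hyperboloid = (a p).hyperboloid := by
  rw [← sub_eq_zero]
  refine eq_zero_of_mform_eq_zero fun y => ?_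
  obtain ⟨y, rfl⟩ := linearize_surjective ha y
  rw [map_sub, LinearMap.sub_apply, mform_linearize ha, ← sum_coord_smul y]
  simp only [map_sum, map_smul]
  rw [sub_eq_zero]
  refine Finset.sum_congr rfl fun j _ => ?_
  congr 1
  rw [linearize_apply]
  have : ∑ i, coord i (frame j).hyperboloid • (a (frame i)).hyperboloid
      = (a (frame j)).hyperboloid := by
    fin_cases j <;> (simp [Fin.sum_univ_four, coord, frame, hyperboloid]; try norm_num)
  rw [this, dist_eq_iff_mform.1 (ha.dist_eq p (frame j))]

/-- A linear map is determined by its values on the hyperboloid. -/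
theorem ext_linear {A B : Mink →L[ℝ] Mink}
    (h : ∀ p : HypThree, A p.hyperboloid = B p.hyperboloid) : A = B := by
  refine ContinuousLinearMap.ext fun x => ?_
  rw [← sum_coord_smul x]
  simp [h]

theorem linearize_symm_apply (a : HypThree ≃ᵢ HypThree) (x : Mink) :
    linearize a.symm (linearize a x) = x := by
  have : (linearize a.symm).comp (linearize a) = ContinuousLinearMap.id ℝ Mink := by
    refine ext_linear fun p => ?_
    simp [linearize_hyperboloid a.isometry, linearize_hyperboloid a.symm.isometry]
  exact DFunLike.congr_fun this x

end HypThree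

/-! ### The closed ball and the light cone. -/

/-- The stereographic embedding of the compactification of `ℂ × ℝ`, in Minkowski coordinates; the
last component is the signed height. -/
noncomputable def ballEmbedding (x : OnePoint (ℂ × ℝ)) : Mink × ℝ :=
  x.elim ((0, 0, 1), 0) fun p : ℂ × ℝ =>
    (1 / (1 + ‖p.1‖ ^ 2 + p.2 ^ 2)) •
      (((1 : ℝ), p.1, ‖p.1‖ ^ 2 + p.2 ^ 2), p.2)

theorem ballEmbedding_coe (p : ℂ × ℝ) : ballEmbedding (p : OnePoint (ℂ × ℝ)) =
    (1 / (1 + ‖p.1‖ ^ 2 + p.2 ^ 2)) •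
      (((1 : ℝ), p.1, ‖p.1‖ ^ 2 + p.2 ^ 2), p.2) := rfl

theorem ballEmbedding_infty : ballEmbedding OnePoint.infty = ((0, 0, 1), 0) := rfl

/-- Since `|f| ≤ √N`, the product is at most `1 / √N`. This gives continuity of `ballEmbedding` at
infinity. -/
theorem tendsto_div_one_add_sq {ι : Type*} {l : Filter ι} {N f : ι → ℝ}
    (hN : Tendsto N l atTop) (hf : ∀ i, f i ^ 2 ≤ N i) :
    Tendsto (fun i => (1 / N i) * f i) l (𝓝 0) := by
  have h1 : Tendsto (fun i => 1 / √(N i)) l (𝓝 0) := by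
    simp only [one_div]
    exact (Real.tendsto_sqrt_atTop.comp hN).inv_tendsto_atTop
  refine squeeze_zero_norm' ?_ h1
  filter_upwards [hN.eventually_gt_atTop 0] with i hi
  have h2 : |f i| ≤ √(N i) := Real.abs_le_sqrt (hf i)
  rw [norm_mul, Real.norm_of_nonneg (by positivity), Real.norm_eq_abs]
  have h3 : 0 < √(N i) := Real.sqrt_pos.2 hi
  calc 1 / N i * |f i| ≤ 1 / N i * √(N i) := by gcongr
    _ = 1 / √(N i) := by
      nth_rewrite 1 [← Real.sq_sqrt hi.le]
      field_simp

theorem tendsto_sq_norm_cocompact :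
    Tendsto (fun p : ℂ × ℝ => 1 + ‖p.1‖ ^ 2 + p.2 ^ 2) (cocompact (ℂ × ℝ)) atTop := by
  have h1 := (tendsto_pow_atTop (two_ne_zero (α := ℕ))).comp
    (tendsto_norm_cocompact_atTop (E := ℂ × ℝ))
  refine tendsto_atTop_mono (fun p => ?_) h1
  simp only [Function.comp_apply, Prod.norm_def]
  rcases max_cases ‖p.1‖ ‖p.2‖ with h | h <;> rw [h.1]
  · nlinarith [sq_nonneg p.2]
  · rw [Real.norm_eq_abs, sq_abs]
    nlinarith [sq_nonneg ‖p.1‖]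

theorem continuous_ballEmbedding : Continuous ballEmbedding := by
  have hpos : ∀ p : ℂ × ℝ, 1 + ‖p.1‖ ^ 2 + p.2 ^ 2 ≠ 0 := fun p => by positivity
  rw [OnePoint.continuous_iff]
  constructor
  · rw [coclosedCompact_eq_cocompact]
    simp only [ballEmbedding_coe, ballEmbedding_infty]
    have hN := tendsto_sq_norm_cocompact
    have h1 := tendsto_div_one_add_sq (f := fun _ => 1) hN
      fun p => by nlinarith [sq_nonneg ‖p.1‖, sq_nonneg p.2]
    have h2 := tendsto_div_one_add_sq (f := fun p => ‖p.1‖) hN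
      fun p => by nlinarith [sq_nonneg ‖p.1‖, sq_nonneg p.2]
    have h3 := tendsto_div_one_add_sq (f := fun p => p.2) hN
      fun p => by nlinarith [sq_nonneg ‖p.1‖, sq_nonneg p.2]
    refine Tendsto.prodMk_nhds (Tendsto.prodMk_nhds h1 (Tendsto.prodMk_nhds ?_ ?_)) h3
    · rw [tendsto_zero_iff_norm_tendsto_zero]
      refine h2.congr fun p => ?_
      change _ = ‖(1 / (1 + ‖p.1‖ ^ 2 + p.2 ^ 2)) • p.1‖
      rw [norm_smul, Real.norm_of_nonneg]
      positivity
    · have h4 := (tendsto_const_nhds (x := (1 : ℝ))).sub h1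
      rw [sub_zero] at h4
      refine h4.congr fun p => ?_
      have := hpos p
      change _ = 1 / (1 + ‖p.1‖ ^ 2 + p.2 ^ 2) * (‖p.1‖ ^ 2 + p.2 ^ 2)
      field_simp
      ring
  · simp only [ballEmbedding_coe]
    refine Continuous.smul (continuous_const.div (by fun_prop) hpos) (by fun_prop)

theorem ballEmbedding_injective : Function.Injective ballEmbedding := by
  have key : ∀ p : ℂ × ℝ, 0 < 1 + ‖p.1‖ ^ 2 + p.2 ^ 2 := fun p => by positivity
  intro p q h
  induction p using OnePoint.rec with
  | infty =>
    induction q using OnePoint.rec with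
    | infty => rfl
    | coe q =>
      have := congrArg (fun x => x.1.1) h
      simp [ballEmbedding_coe, ballEmbedding_infty, (key q).ne] at this
  | coe p =>
    induction q using OnePoint.rec with
    | infty =>
      have := congrArg (fun x => x.1.1) h
      simp [ballEmbedding_coe, ballEmbedding_infty] at this
      exact absurd this (key p).ne'
    | coe q =>
      have h1 := congrArg (fun x => x.1.1) h
      have h2 := congrArg (fun x => x.1.2.1) h
      have h3 := congrArg (fun x => x.2) h
      simp only [ballEmbedding_coe, Prod.smul_fst, Prod.smul_snd, smul_eq_mul, mul_one]
        at h1 h2 h3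
      rw [h1] at h2 h3
      have h4 : 1 / (1 + ‖q.1‖ ^ 2 + q.2 ^ 2) ≠ 0 := (one_div_pos.2 (key q)).ne'
      rw [Prod.ext (smul_right_injective ℂ h4 h2) (mul_left_cancel₀ h4 h3)]

theorem isClosedEmbedding_ballEmbedding : IsClosedEmbedding ballEmbedding :=
  continuous_ballEmbedding.isClosedEmbedding ballEmbedding_injective

namespace RSphere

theorem toBall_injective : Function.Injective toBall :=
  Option.map_injective fun _ _ h => congrArg Prod.fst h

theorem continuous_toBall : Continuous toBall := by
  refine OnePoint.continuous_map (by fun_prop) ?_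
  simp only [coclosedCompact_eq_cocompact]
  have : Isometry fun z : ℂ => (z, (0 : ℝ)) := Isometry.of_dist_eq fun x y => by
    simp [Prod.dist_eq]
  exact this.isClosedEmbedding.tendsto_cocompact

/-- The sphere as the projectivized light cone. -/
noncomputable def toCone (ξ : RSphere) : Mink := (ballEmbedding ξ.toBall).1

theorem toCone_coe (z : ℂ) : toCone (z : RSphere) =
    (1 / (1 + ‖z‖ ^ 2)) • ((1 : ℝ), z, ‖z‖ ^ 2) := by
  simp [toCone, toBall, ballEmbedding_coe]

theorem toCone_infty : toCone OnePoint.infty = (0, 0, 1) := rfl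

theorem ballEmbedding_toBall (ξ : RSphere) : ballEmbedding ξ.toBall = (ξ.toCone, 0) := by
  induction ξ using OnePoint.rec with
  | infty => rfl
  | coe z => simp [toCone, toBall, ballEmbedding_coe]

theorem continuous_toCone : Continuous toCone :=
  continuous_fst.comp (continuous_ballEmbedding.comp continuous_toBall)

theorem toCone_injective : Function.Injective toCone := by
  intro ξ η h
  apply toBall_injective
  apply ballEmbedding_injective
  rw [ballEmbedding_toBall, ballEmbedding_toBall, h]

theorem isClosedEmbedding_toCone : IsClosedEmbedding toCone :=
  continuous_toCone.isClosedEmbedding toCone_injective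

theorem mform_toCone_self (ξ : RSphere) : mform ξ.toCone ξ.toCone = 0 := by
  induction ξ using OnePoint.rec with
  | infty => simp [toCone_infty, mform_apply]
  | coe z =>
    simp only [toCone_coe, map_smul, LinearMap.smul_apply, mform_apply, HypThree.norm_sq_eq]
    simp
    exact Or.inr (by ring)

theorem mtrace_toCone (ξ : RSphere) : mtrace ξ.toCone = 1 := by
  induction ξ using OnePoint.rec with
  | infty => simp [toCone_infty]
  | coe z =>
    have : 1 + ‖z‖ ^ 2 ≠ 0 := by positivity
    rw [toCone_coe, map_smul]
    simp
    field_simp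

theorem exists_toCone_eq {x : Mink} (h : mform x x = 0) (h1 : mtrace x = 1) :
    ∃ ξ : RSphere, ξ.toCone = x := by
  obtain ⟨a, z, c⟩ := x
  simp only [mform_apply, mtrace_apply] at h h1
  by_cases ha : a = 0
  · refine ⟨OnePoint.infty, ?_⟩
    subst ha
    have h2 : z.re ^ 2 + z.im ^ 2 = 0 := by nlinarith
    have h3 : z = 0 := by
      rw [← HypThree.norm_sq_eq] at h2
      simpa using h2
    rw [toCone_infty, h3, show c = 1 by linarith]
  · have h2 : a * c = z.re ^ 2 + z.im ^ 2 := by nlinarith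
    have hz : ‖(1 / a : ℝ) • z‖ ^ 2 = (1 - a) / a := by
      rw [norm_smul, mul_pow, HypThree.norm_sq_eq, Real.norm_eq_abs, sq_abs, ← h2]
      field_simp
      linarith
    refine ⟨(((1 / a : ℝ) • z : ℂ) : OnePoint ℂ), ?_⟩
    rw [toCone_coe, hz]
    have h3 : 1 / (1 + (1 - a) / a) = a := by field_simp; ring
    rw [h3]
    refine Prod.ext (by simp) (Prod.ext ?_ ?_)
    · simp only [Prod.smul_snd, Prod.smul_fst, smul_smul]
      rw [show a * (1 / a) = 1 by field_simp, one_smul]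
    · simp only [Prod.smul_snd, smul_eq_mul]
      field_simp
      linarith

/-- The Lorentz product of a light vector and a point of the hyperboloid is positive. -/
theorem mform_toCone_hyperboloid_pos (ξ : RSphere) (p : HypThree) :
    0 < mform ξ.toCone p.hyperboloid := by
  have hp := p.pos
  induction ξ using OnePoint.rec with
  | infty => simpa [toCone_infty, mform_apply, HypThree.hyperboloid] using hp
  | coe z =>
    have : mform (toCone (z : RSphere)) p.hyperboloid =
        (‖z - p.z‖ ^ 2 + p.t ^ 2) / (2 * p.t * (1 + ‖z‖ ^ 2)) := by
      simp only [toCone_coe, map_smul, LinearMap.smul_apply, mform_apply, HypThree.hyperboloid,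
        HypThree.norm_sq_eq]
      simp
      field_simp
      ring
    rw [this]
    positivity

/-- This is one eighth of the squared chordal distance, so a lower bound on such products is a
quantitative form of separation of ideal points. -/
theorem mform_toCone_coe (z w : ℂ) : mform (toCone (z : RSphere)) (toCone (w : RSphere)) =
    ‖z - w‖ ^ 2 / (2 * (1 + ‖z‖ ^ 2) * (1 + ‖w‖ ^ 2)) := by
  have h1 : 1 + ‖z‖ ^ 2 ≠ 0 := by positivity
  have h2 : 1 + ‖w‖ ^ 2 ≠ 0 := by positivity
  simp only [toCone_coe, map_smul, LinearMap.smul_apply]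
  rw [smul_eq_mul, smul_eq_mul, mform_apply]
  field_simp
  simp only [HypThree.norm_sq_eq]
  simp
  ring

theorem mform_toCone_infty (z : ℂ) :
    mform (toCone (z : RSphere)) (toCone OnePoint.infty) = 1 / (2 * (1 + ‖z‖ ^ 2)) := by
  simp only [toCone_coe, map_smul, LinearMap.smul_apply, toCone_infty]
  rw [smul_eq_mul, mform_apply]
  simp

theorem mform_toCone_nonneg (ξ η : RSphere) : 0 ≤ mform ξ.toCone η.toCone := by
  induction ξ using OnePoint.rec with
  | infty =>
    induction η using OnePoint.rec with
    | infty => rw [mform_toCone_self]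
    | coe w => rw [mform_comm, mform_toCone_infty]; positivity
  | coe z =>
    induction η using OnePoint.rec with
    | infty => rw [mform_toCone_infty]; positivity
    | coe w => rw [mform_toCone_coe]; positivity

theorem mform_toCone_pos {ξ η : RSphere} (h : ξ ≠ η) : 0 < mform ξ.toCone η.toCone := by
  induction ξ using OnePoint.rec with
  | infty =>
    induction η using OnePoint.rec with
    | infty => exact absurd rfl h
    | coe w => rw [mform_comm, mform_toCone_infty]; positivity
  | coe z =>
    induction η using OnePoint.rec with
    | infty => rw [mform_toCone_infty]; positivity
    | coe w =>
      have : 0 < ‖z - w‖ := norm_pos_iff.2 (sub_ne_zero.2 fun h' => h (by rw [h']))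
      rw [mform_toCone_coe]; positivity

end RSphere

/-! ### The projective model and the action of isometries on the sphere. -/

namespace HypThree

/-- The projective model. -/
noncomputable def toCone (p : HypThree) : Mink := (mtrace p.hyperboloid)⁻¹ • p.hyperboloid

/-- The height component is a function of the projective component, so convergence to ideal points
can be tested in the projective model alone. -/
theorem ballEmbedding_toBall (p : HypThree) :
    ballEmbedding p.toBall = (p.toCone, √(mform p.toCone p.toCone)) := by
  have hp := p.pos
  have h0 : 0 < 1 + ‖p.z‖ ^ 2 + p.t ^ 2 := by positivity
  have h1 : mtrace p.hyperboloid = (1 + ‖p.z‖ ^ 2 + p.t ^ 2) / p.t := by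
    simp only [mtrace_apply, hyperboloid]; ring
  have h2 : p.toCone = (1 / (1 + ‖p.z‖ ^ 2 + p.t ^ 2)) •
      ((1 : ℝ), p.z, ‖p.z‖ ^ 2 + p.t ^ 2) := by
    rw [toCone, h1, hyperboloid]
    refine Prod.ext ?_ (Prod.ext ?_ ?_)
    · simp; field_simp
    · simp only [Prod.smul_snd, Prod.smul_fst, smul_smul]
      congr 1
      field_simp
    · simp only [Prod.smul_snd, smul_eq_mul]
      field_simp
  have h3 : mform p.toCone p.toCone = (p.t / (1 + ‖p.z‖ ^ 2 + p.t ^ 2)) ^ 2 := by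
    rw [toCone]
    simp only [map_smul, LinearMap.smul_apply, mform_hyperboloid_self, smul_eq_mul, h1]
    field_simp
  rw [h3, Real.sqrt_sq (by positivity), h2, toBall, ballEmbedding_coe]
  refine Prod.ext rfl ?_
  simp only [Prod.smul_snd, smul_eq_mul]
  ring

/-- The filter of neighbourhoods of an ideal point, in the projective model. -/
theorem comap_toBall_nhds (ξ : RSphere) :
    comap toBall (𝓝 ξ.toBall) = comap toCone (𝓝 ξ.toCone) := by
  rw [isClosedEmbedding_ballEmbedding.isInducing.nhds_eq_comap, comap_comap,
    RSphere.ballEmbedding_toBall]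
  have h0 : ballEmbedding ∘ toBall = fun p => (p.toCone, √(mform p.toCone p.toCone)) :=
    funext ballEmbedding_toBall
  rw [h0, nhds_prod_eq, comap_prod]
  -- Light vectors are null, so the height tends to `0` automatically when the projective component
  -- converges.
  refine le_antisymm inf_le_left (le_inf le_rfl ?_)
  rw [← tendsto_iff_comap]
  have h1 : Continuous fun x : Mink => √(mform x x) :=
    Real.continuous_sqrt.comp (continuous_mform.comp (continuous_id.prodMk continuous_id))
  have h2 := h1.tendsto ξ.toCone
  rw [RSphere.mform_toCone_self, Real.sqrt_zero] at h2
  exact h2.comp tendsto_comap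

end HypThree

theorem isBoundaryExtension_iff {H : HypThree → HypThree} {h : RSphere ≃ₜ RSphere} :
    IsBoundaryExtension H h ↔ ∀ ξ : RSphere,
      Tendsto H (comap HypThree.toBall (𝓝 ξ.toBall))
        (comap HypThree.toBall (𝓝 (h ξ).toBall)) :=
  forall_congr' fun _ => (tendsto_comap_iff (g := HypThree.toBall)).symm

theorem IsBoundaryExtension.comp {G H : HypThree → HypThree} {g h : RSphere ≃ₜ RSphere}
    (hg : IsBoundaryExtension G g) (hh : IsBoundaryExtension H h) :
    IsBoundaryExtension (G ∘ H) (g * h) := by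
  rw [isBoundaryExtension_iff] at *
  exact fun ξ => (hg (h ξ)).comp (hh ξ)

/-- Every ideal point is a limit along a vertical ray. Without this, boundary extensions would not
be unique. -/
instance neBot_comap_toBall (ξ : RSphere) : (comap HypThree.toBall (𝓝 ξ.toBall)).NeBot := by
  have key : ∀ u : ℝ → ℂ × ℝ, (∀ t, (u t).2 = t) → ∀ l : Filter ℝ, l.NeBot →
      (∀ᶠ t in l, 0 < t) → Tendsto (fun t => (u t : OnePoint (ℂ × ℝ))) l (𝓝 ξ.toBall) →
      (comap HypThree.toBall (𝓝 ξ.toBall)).NeBot := by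
    intro u hu l hl h0 ht
    rw [comap_neBot_iff]
    intro s hs
    obtain ⟨t, h1, h2⟩ := (h0.and (ht.eventually_mem hs)).exists
    refine ⟨⟨(u t).1, t, h1⟩, ?_⟩
    have : (((u t).1, t) : ℂ × ℝ) = u t := Prod.ext rfl (hu t).symm
    simpa only [HypThree.toBall, this] using h2
  induction ξ using OnePoint.rec with
  | infty =>
    refine key (fun t => (0, t)) (fun _ => rfl) atTop inferInstance
      (eventually_gt_atTop 0) ?_
    have h1 : Tendsto (fun t : ℝ => ((0 : ℂ), t)) atTop (cocompact (ℂ × ℝ)) :=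
      (Isometry.of_dist_eq fun x y => by simp [Prod.dist_eq]).isClosedEmbedding.tendsto_cocompact.comp
        atTop_le_cocompact
    have h2 := OnePoint.tendsto_coe_infty (X := ℂ × ℝ)
    rw [coclosedCompact_eq_cocompact] at h2
    exact h2.comp h1
  | coe z =>
    refine key (fun t => (z, t)) (fun _ => rfl) (𝓝[>] 0) inferInstance
      self_mem_nhdsWithin ?_
    have h1 : Continuous fun t : ℝ => (((z, t) : ℂ × ℝ) : OnePoint (ℂ × ℝ)) :=
      OnePoint.continuous_coe.comp (by fun_prop)
    exact (h1.tendsto 0).mono_left nhdsWithin_le_nhds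

theorem IsBoundaryExtension.unique {H : HypThree → HypThree} {h h' : RSphere ≃ₜ RSphere}
    (h1 : IsBoundaryExtension H h) (h2 : IsBoundaryExtension H h') : h = h' := by
  ext ξ
  exact RSphere.toBall_injective (tendsto_nhds_unique (h1 ξ) (h2 ξ))

namespace HypThree

theorem mtrace_linearize (a : HypThree ≃ᵢ HypThree) (x : Mink) :
    mtrace (linearize a x) = 2 * mform x (a.symm base).hyperboloid := by
  rw [mtrace_eq_mform, ← mform_linearize a.symm.isometry, linearize_symm_apply,
    linearize_hyperboloid a.symm.isometry]

theorem mtrace_linearize_toCone_pos (a : HypThree ≃ᵢ HypThree) (ξ : RSphere) :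
    0 < mtrace (linearize a ξ.toCone) := by
  rw [mtrace_linearize]
  have := RSphere.mform_toCone_hyperboloid_pos ξ (a.symm base)
  positivity

/-- A Lorentz map preserves null vectors; dividing by the positive trace returns the image to the
normalized light cone. -/
theorem exists_boundaryMap (a : HypThree ≃ᵢ HypThree) (ξ : RSphere) : ∃ η : RSphere,
    η.toCone = (mtrace (linearize a ξ.toCone))⁻¹ • linearize a ξ.toCone := by
  refine RSphere.exists_toCone_eq ?_ ?_
  · simp [mform_linearize a.isometry, RSphere.mform_toCone_self]
  · rw [map_smul, smul_eq_mul, inv_mul_cancel₀ (mtrace_linearize_toCone_pos a ξ).ne']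

/-- The action of an isometry on the sphere. -/
noncomputable def boundaryMap (a : HypThree ≃ᵢ HypThree) (ξ : RSphere) : RSphere :=
  (exists_boundaryMap a ξ).choose

theorem toCone_boundaryMap (a : HypThree ≃ᵢ HypThree) (ξ : RSphere) :
    (boundaryMap a ξ).toCone = (mtrace (linearize a ξ.toCone))⁻¹ • linearize a ξ.toCone :=
  (exists_boundaryMap a ξ).choose_spec

theorem boundaryMap_symm_apply (a : HypThree ≃ᵢ HypThree) (ξ : RSphere) :
    boundaryMap a.symm (boundaryMap a ξ) = ξ := by
  apply RSphere.toCone_injective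
  have h := (mtrace_linearize_toCone_pos a ξ).ne'
  rw [toCone_boundaryMap, toCone_boundaryMap, map_smul, map_smul, linearize_symm_apply,
    RSphere.mtrace_toCone, smul_smul, smul_eq_mul, mul_one, inv_inv, mul_inv_cancel₀ h, one_smul]

theorem continuous_boundaryMap (a : HypThree ≃ᵢ HypThree) : Continuous (boundaryMap a) := by
  rw [RSphere.isClosedEmbedding_toCone.isInducing.continuous_iff]
  have h1 : Continuous fun ξ : RSphere => linearize a ξ.toCone :=
    (linearize a).continuous.comp RSphere.continuous_toCone
  refine Continuous.congr (((mtrace.continuous.comp h1).inv₀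
    fun ξ => (mtrace_linearize_toCone_pos a ξ).ne').smul h1) fun ξ => ?_
  exact (toCone_boundaryMap a ξ).symm

/-- The action of an isometry on the sphere, as a homeomorphism. -/
noncomputable def boundaryHomeo (a : HypThree ≃ᵢ HypThree) : RSphere ≃ₜ RSphere where
  toFun := boundaryMap a
  invFun := boundaryMap a.symm
  left_inv := boundaryMap_symm_apply a
  right_inv := boundaryMap_symm_apply a.symm
  continuous_toFun := continuous_boundaryMap a
  continuous_invFun := continuous_boundaryMap a.symm

theorem toCone_boundaryHomeo (a : HypThree ≃ᵢ HypThree) (ξ : RSphere) :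
    (boundaryHomeo a ξ).toCone = (mtrace (linearize a ξ.toCone))⁻¹ • linearize a ξ.toCone :=
  toCone_boundaryMap a ξ

theorem isBoundaryExtension_boundaryHomeo (a : HypThree ≃ᵢ HypThree) :
    IsBoundaryExtension a (boundaryHomeo a) := by
  rw [isBoundaryExtension_iff]
  intro ξ
  rw [comap_toBall_nhds, comap_toBall_nhds, tendsto_comap_iff, toCone_boundaryHomeo]
  -- In the projective model the isometry is the restriction of a projective map that is also
  -- defined and continuous at ideal points.
  have h0 : toCone ∘ a =
      (fun x : Mink => (mtrace (linearize a x))⁻¹ • linearize a x) ∘ toCone := by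
    funext p
    have h := (mtrace_hyperboloid_pos p).ne'
    simp only [Function.comp_apply, toCone, map_smul, linearize_hyperboloid a.isometry,
      smul_smul, smul_eq_mul]
    congr 1
    field_simp
  rw [h0]
  refine Tendsto.comp ?_ tendsto_comap
  have h1 : ContinuousAt (fun x : Mink => (mtrace (linearize a x))⁻¹ • linearize a x)
      ξ.toCone :=
    ((mtrace.continuous.comp (linearize a).continuous).continuousAt.inv₀
      (mtrace_linearize_toCone_pos a ξ).ne').smul (linearize a).continuous.continuousAt
  exact h1

theorem boundaryHomeo_mul (a b : HypThree ≃ᵢ HypThree) :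
    boundaryHomeo (a * b) = boundaryHomeo a * boundaryHomeo b :=
  (isBoundaryExtension_boundaryHomeo (a * b)).unique
    ((isBoundaryExtension_boundaryHomeo a).comp (isBoundaryExtension_boundaryHomeo b))

theorem boundaryHomeo_one : boundaryHomeo 1 = 1 := by
  have := boundaryHomeo_mul 1 1
  rwa [one_mul, left_eq_mul] at this

theorem boundaryHomeo_inv (a : HypThree ≃ᵢ HypThree) :
    boundaryHomeo a⁻¹ = (boundaryHomeo a)⁻¹ := by
  rw [eq_inv_iff_mul_eq_one, ← boundaryHomeo_mul, inv_mul_cancel, boundaryHomeo_one]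

/-- The Lorentz product of the images of two ideal points. -/
theorem mform_boundaryHomeo (a : HypThree ≃ᵢ HypThree) (ξ η : RSphere) :
    mform (boundaryHomeo a ξ).toCone (boundaryHomeo a η).toCone =
      mform ξ.toCone η.toCone /
        (mtrace (linearize a ξ.toCone) * mtrace (linearize a η.toCone)) := by
  simp only [toCone_boundaryHomeo, map_smul, LinearMap.smul_apply, mform_linearize a.isometry,
    smul_eq_mul]
  rw [div_eq_mul_inv, mul_inv]
  ring

end HypThree

/-! ### Continuous convergence and compactness of sets of isometries. -/

/-- Continuous convergence of a sequence of maps. -/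
def TendstoContinuously {X Y : Type*} [TopologicalSpace X] [TopologicalSpace Y]
    (F : ℕ → X → Y) (f : X → Y) : Prop :=
  ∀ x, Tendsto (fun p : ℕ × X => F p.1 p.2) (atTop ×ˢ 𝓝 x) (𝓝 (f x))

namespace TendstoContinuously

variable {X Y Z : Type*} [TopologicalSpace X] [TopologicalSpace Y] [TopologicalSpace Z]

theorem const {f : X → Y} (hf : Continuous f) : TendstoContinuously (fun _ => f) f :=
  fun x => (hf.tendsto x).comp tendsto_snd

theorem comp {G : ℕ → Y → Z} {g : Y → Z} {F : ℕ → X → Y} {f : X → Y}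
    (hG : TendstoContinuously G g) (hF : TendstoContinuously F f) :
    TendstoContinuously (fun n => G n ∘ F n) (g ∘ f) := fun x =>
  (hG (f x)).comp (tendsto_fst.prodMk (hF x))

theorem tendsto_apply {F : ℕ → X → Y} {f : X → Y} (hF : TendstoContinuously F f) {u : ℕ → X}
    {x : X} (hu : Tendsto u atTop (𝓝 x)) : Tendsto (fun n => F n (u n)) atTop (𝓝 (f x)) :=
  (hF x).comp (tendsto_id.prodMk hu)

theorem tendstoUniformlyOn {X Y : Type*} [TopologicalSpace X] [UniformSpace Y]
    {F : ℕ → X → Y} {f : X → Y} (hF : TendstoContinuously F f) (hf : Continuous f)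
    {K : Set X} (hK : IsCompact K) : TendstoUniformlyOn F f atTop K := by
  rw [← tendstoLocallyUniformlyOn_iff_tendstoUniformlyOn_of_compact hK]
  refine TendstoLocallyUniformly.tendstoLocallyUniformlyOn ?_
  rw [tendstoLocallyUniformly_iff_forall_tendsto]
  intro x
  refine Tendsto.mono_right ?_ (nhds_le_uniformity (f x))
  rw [nhds_prod_eq]
  exact ((hf.tendsto x).comp tendsto_snd).prodMk (hF x)

theorem sphereTendstoUniformly {F : ℕ → RSphere → RSphere} {f : RSphere → RSphere}
    (hF : TendstoContinuously F f) (hf : Continuous f) : SphereTendstoUniformly F f := by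
  let _ : UniformSpace RSphere := uniformSpaceOfCompactR1
  exact tendstoUniformlyOn_univ.1 (hF.tendstoUniformlyOn hf isCompact_univ)

end TendstoContinuously

theorem Filter.Tendsto.mink_apply {ι : Type*} {l : Filter ι} {A : ι → Mink →L[ℝ] Mink}
    {B : Mink →L[ℝ] Mink} {u : ι → Mink} {x : Mink} (hA : Tendsto A l (𝓝 B))
    (hu : Tendsto u l (𝓝 x)) : Tendsto (fun i => A i (u i)) l (𝓝 (B x)) :=
  (isBoundedBilinearMap_apply.continuous.tendsto (B, x)).comp (hA.prodMk_nhds hu)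

namespace HypThree

theorem tendsto_of_mform_tendsto {ι : Type*} {l : Filter ι} {p : ι → HypThree} {q : HypThree}
    (h : Tendsto (fun i => mform (p i).hyperboloid q.hyperboloid) l (𝓝 1)) :
    Tendsto p l (𝓝 q) := by
  rw [tendsto_iff_dist_tendsto_zero]
  have h1 : Tendsto (fun i => Real.cosh (dist (p i) q)) l (𝓝[Ici 1] 1) :=
    tendsto_nhdsWithin_iff.2 ⟨by simpa only [mform_hyperboloid] using h,
      Eventually.of_forall fun i => Real.one_le_cosh _⟩
  have h2 := (Real.continuousOn_arcosh 1 self_mem_Ici).tendsto.comp h1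
  rw [Real.arcosh_zero] at h2
  exact h2.congr fun i => Real.arcosh_cosh dist_nonneg

theorem norm_hyperboloid_le (p : HypThree) :
    ‖p.hyperboloid‖ ≤ 2 * Real.cosh (dist p base) := by
  have hp := p.pos
  have h1 : 2 * Real.cosh (dist p base) = (1 + ‖p.z‖ ^ 2 + p.t ^ 2) / p.t := by
    rw [← mform_hyperboloid, ← mtrace_eq_mform]
    simp only [mtrace_apply, hyperboloid]; ring
  rw [h1, Prod.norm_def, Prod.norm_def]
  simp only [hyperboloid, norm_smul]
  rw [Real.norm_of_nonneg (by positivity), Real.norm_of_nonneg (by positivity)]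
  refine max_le ?_ (max_le ?_ ?_)
  · gcongr
    nlinarith [sq_nonneg ‖p.z‖]
  · rw [div_mul_eq_mul_div, one_mul]
    gcongr
    nlinarith [sq_nonneg (‖p.z‖ - 1)]
  · gcongr
    linarith

theorem norm_linearize_le {a : HypThree ≃ᵢ HypThree} {R : ℝ} (h : dist (a base) base ≤ R) :
    ‖linearize a‖ ≤ ∑ i, ‖coord i‖ * (2 * Real.cosh (dist (frame i) base + R)) := by
  refine (norm_sum_le _ _).trans (Finset.sum_le_sum fun i _ => ?_)
  rw [ContinuousLinearMap.norm_smulRight_apply]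
  have h1 : dist (a (frame i)) base ≤ dist (frame i) base + R :=
    (dist_triangle _ (a base) _).trans (by rw [a.dist_eq]; gcongr)
  have h2 : Real.cosh (dist (a (frame i)) base) ≤ Real.cosh (dist (frame i) base + R) := by
    rw [Real.cosh_le_cosh, abs_of_nonneg dist_nonneg]
    exact h1.trans (le_abs_self _)
  gcongr
  exact (norm_hyperboloid_le _).trans (by linarith)

/-- A limit of Lorentz maps preserves the form, and the sign of the first coordinate survives in the
limit, so points stay on the same sheet. -/
theorem exists_isometry_of_tendsto {a : ℕ → HypThree → HypThree} (ha : ∀ n, Isometry (a n))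
    {A : Mink →L[ℝ] Mink} (hA : Tendsto (fun n => linearize (a n)) atTop (𝓝 A)) :
    ∃ b : HypThree → HypThree, Isometry b ∧ ∀ p, (b p).hyperboloid = A p.hyperboloid := by
  have h1 : ∀ x, Tendsto (fun n => linearize (a n) x) atTop (𝓝 (A x)) := fun x =>
    hA.mink_apply tendsto_const_nhds
  have h2 : ∀ x y, mform (A x) (A y) = mform x y := fun x y => by
    have := (continuous_mform.tendsto (A x, A y)).comp ((h1 x).prodMk_nhds (h1 y))
    refine tendsto_nhds_unique this (tendsto_const_nhds.congr fun n => ?_)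
    exact (mform_linearize (ha n) x y).symm
  have h3 : ∀ p : HypThree, ∃ q : HypThree, q.hyperboloid = A p.hyperboloid := fun p => by
    refine exists_hyperboloid_eq (by rw [h2, mform_hyperboloid_self]) ?_
    refine ge_of_tendsto' ((continuous_fst.tendsto _).comp (h1 p.hyperboloid)) fun n => ?_
    have := (a n p).pos
    simp only [Function.comp_apply, linearize_hyperboloid (ha n)]
    exact (one_div_pos.2 this).le
  choose b hb using h3
  refine ⟨b, Isometry.of_dist_eq fun p q => ?_, hb⟩
  rw [dist_eq_iff_mform, hb, hb, h2]

/-- Sequential compactness of the set of isometries that move the base point a bounded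
distance. -/
theorem exists_subseq_linearize_tendsto {a : ℕ → HypThree ≃ᵢ HypThree} {R : ℝ}
    (ha : ∀ n, dist (a n base) base ≤ R) : ∃ (b : HypThree ≃ᵢ HypThree) (s : ℕ → ℕ),
      StrictMono s ∧ Tendsto (fun n => linearize (a (s n))) atTop (𝓝 (linearize b)) := by
  have ha' : ∀ n, dist ((a n).symm base) base ≤ R := fun n => by
    rw [← (a n).dist_eq, (a n).apply_symm_apply, dist_comm]
    exact ha n
  -- The inverses are carried along so that the limit has an inverse as well.
  obtain ⟨⟨A, A'⟩, -, s, hs, h⟩ := tendsto_subseq_of_bounded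
    (Metric.isBounded_closedBall (x := (0 : (Mink →L[ℝ] Mink) × (Mink →L[ℝ] Mink)))
      (r := ∑ i, ‖coord i‖ * (2 * Real.cosh (dist (frame i) base + R))))
    (x := fun n => (linearize (a n), linearize (a n).symm))
    fun n => by
      rw [mem_closedBall_zero_iff]
      exact max_le (norm_linearize_le (ha n)) (norm_linearize_le (ha' n))
  have hA : Tendsto (fun n => linearize (a (s n))) atTop (𝓝 A) := h.fst_nhds
  have hA' : Tendsto (fun n => linearize (a (s n)).symm) atTop (𝓝 A') := h.snd_nhds
  have h1 : ∀ x, A' (A x) = x := fun x => by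
    refine tendsto_nhds_unique (hA'.mink_apply (hA.mink_apply tendsto_const_nhds))
      (tendsto_const_nhds.congr fun n => ?_)
    exact (linearize_symm_apply (a (s n)) x).symm
  have h2 : ∀ x, A (A' x) = x := fun x => by
    refine tendsto_nhds_unique (hA.mink_apply (hA'.mink_apply tendsto_const_nhds))
      (tendsto_const_nhds.congr fun n => ?_)
    exact (linearize_symm_apply (a (s n)).symm x).symm
  obtain ⟨b, hb, hbA⟩ := exists_isometry_of_tendsto (fun n => (a (s n)).isometry) hA
  obtain ⟨b', hb', hbA'⟩ := exists_isometry_of_tendsto (fun n => (a (s n)).symm.isometry) hA'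
  refine ⟨⟨⟨b, b', fun p => hyperboloid_injective ?_, fun p => hyperboloid_injective ?_⟩, hb⟩,
    s, hs, ?_⟩
  · rw [hbA', hbA, h1]
  · rw [hbA, hbA', h2]
  · convert hA
    refine ext_linear fun p => ?_
    erw [linearize_hyperboloid hb, hbA]

theorem tendstoContinuously_of_linearize {a : ℕ → HypThree ≃ᵢ HypThree} {b : HypThree ≃ᵢ HypThree}
    (h : Tendsto (fun n => linearize (a n)) atTop (𝓝 (linearize b))) :
    TendstoContinuously (fun n => a n) b := by
  have h1 : ∀ p, Tendsto (fun n => a n p) atTop (𝓝 (b p)) := fun p => by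
    refine tendsto_of_mform_tendsto ?_
    have h2 : Tendsto (fun n => linearize (a n) p.hyperboloid) atTop
        (𝓝 (linearize b p.hyperboloid)) := h.mink_apply tendsto_const_nhds
    have h3 := (continuous_mform.tendsto (_, linearize b p.hyperboloid)).comp
      (h2.prodMk_nhds tendsto_const_nhds)
    simp only [mform_linearize b.isometry, mform_hyperboloid_self] at h3
    refine h3.congr fun n => ?_
    simp only [Function.comp_apply, linearize_hyperboloid (a n).isometry,
      linearize_hyperboloid b.isometry]
  intro p
  rw [tendsto_iff_dist_tendsto_zero]
  have h4 : Tendsto (fun x : ℕ × HypThree => dist x.2 p + dist (a x.1 p) (b p))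
      (atTop ×ˢ 𝓝 p) (𝓝 (0 + 0)) :=
    ((tendsto_iff_dist_tendsto_zero.1 tendsto_id).comp tendsto_snd).add
      ((tendsto_iff_dist_tendsto_zero.1 (h1 p)).comp tendsto_fst)
  rw [add_zero] at h4
  refine squeeze_zero (fun _ => dist_nonneg) (fun x => ?_) h4
  exact (dist_triangle _ (a x.1 p) _).trans (by rw [(a x.1).dist_eq])

theorem tendstoContinuously_boundaryHomeo {a : ℕ → HypThree ≃ᵢ HypThree}
    {b : HypThree ≃ᵢ HypThree}
    (h : Tendsto (fun n => linearize (a n)) atTop (𝓝 (linearize b))) :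
    TendstoContinuously (fun n => boundaryHomeo (a n)) (boundaryHomeo b) := by
  intro ξ
  rw [RSphere.isClosedEmbedding_toCone.isInducing.tendsto_nhds_iff, toCone_boundaryHomeo]
  have h1 : Tendsto (fun x : ℕ × RSphere => linearize (a x.1) x.2.toCone) (atTop ×ˢ 𝓝 ξ)
      (𝓝 (linearize b ξ.toCone)) :=
    (h.comp tendsto_fst).mink_apply ((RSphere.continuous_toCone.tendsto ξ).comp tendsto_snd)
  refine ((((mtrace.continuous.tendsto _).comp h1).inv₀
    (mtrace_linearize_toCone_pos b ξ).ne').smul h1).congr fun x => ?_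
  exact (toCone_boundaryHomeo (a x.1) x.2).symm

end HypThree

/-! ### Lattices, renormalization and limits of equivariant pairs. -/

open HypThree

theorem IsNiceLattice.conj {Γ : Subgroup (HypThree ≃ᵢ HypThree)} (hΓ : IsNiceLattice Γ)
    (c : HypThree ≃ᵢ HypThree) : IsNiceLattice (Γ.map (MulAut.conj c).toMonoidHom) where
  free := by
    rintro _ ⟨g, hg, rfl⟩ p hp
    have h1 : c (g (c⁻¹ p)) = p := hp
    have h2 : g (c⁻¹ p) = c⁻¹ p := by
      conv_rhs => rw [← h1]
      simp
    rw [hΓ.free g hg _ h2, map_one]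
  discontinuous := by
    intro K hK
    have hK' : IsCompact (c ⁻¹' K) := by
      rw [← IsometryEquiv.image_symm]
      exact hK.image c.symm.continuous
    refine ((hΓ.discontinuous _ hK').image (MulAut.conj c)).subset ?_
    rintro _ ⟨⟨g, hg, rfl⟩, x, ⟨y, hy, rfl⟩, hx⟩
    refine ⟨g, ⟨hg, g (c⁻¹ y), ⟨c⁻¹ y, ?_, rfl⟩, hx⟩, rfl⟩
    simpa using hy
  cocompact := by
    obtain ⟨K, hK, h⟩ := hΓ.cocompact
    refine ⟨c '' K, hK.image c.continuous, fun p => ?_⟩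
    obtain ⟨g, hg, hp⟩ := h (c⁻¹ p)
    exact ⟨_, ⟨g, hg, rfl⟩, ⟨_, hp, rfl⟩⟩

theorem mem_boundaryAction_iff {Γ : Subgroup (HypThree ≃ᵢ HypThree)} {φ : RSphere ≃ₜ RSphere} :
    φ ∈ boundaryAction Γ ↔ ∃ g ∈ Γ, φ = boundaryHomeo g :=
  exists_congr fun g => and_congr_right fun _ =>
    ⟨fun h => h.unique (isBoundaryExtension_boundaryHomeo g),
      fun h => h ▸ isBoundaryExtension_boundaryHomeo g⟩

/-- Both sides, composed with `h`, extend the same map of hyperbolic space, so uniqueness of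
extensions applies. -/
theorem conj_boundaryHomeo_eq {H : Equiv.Perm HypThree} {h : RSphere ≃ₜ RSphere}
    (hh : IsBoundaryExtension H h) {g g' : HypThree ≃ᵢ HypThree}
    (hg : H * g.toEquiv * H⁻¹ = g'.toEquiv) : h * boundaryHomeo g * h⁻¹ = boundaryHomeo g' := by
  rw [mul_inv_eq_iff_eq_mul] at hg ⊢
  have h1 : H ∘ g = g' ∘ H := congrArg (fun e : Equiv.Perm HypThree => (e : HypThree → HypThree)) hg
  refine (hh.comp (isBoundaryExtension_boundaryHomeo g)).unique ?_
  rw [h1]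
  exact (isBoundaryExtension_boundaryHomeo g').comp hh

/-- The boundary half of equivariance follows from the interior half, so it need not be checked
separately for new pairs. -/
theorem image_boundaryAction {H : Equiv.Perm HypThree} {h : RSphere ≃ₜ RSphere}
    (hh : IsBoundaryExtension H h) {Γ₁ Γ₂ : Subgroup (HypThree ≃ᵢ HypThree)}
    (hΓ : (fun g : HypThree ≃ᵢ HypThree => H * g.toEquiv * H⁻¹) ''
      (Γ₁ : Set (HypThree ≃ᵢ HypThree)) = IsometryEquiv.toEquiv '' (Γ₂ : Set _)) :
    (fun φ : RSphere ≃ₜ RSphere => h * φ * h⁻¹) '' boundaryAction Γ₁ = boundaryAction Γ₂ := by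
  ext φ
  constructor
  · rintro ⟨ψ, hψ, rfl⟩
    obtain ⟨g, hg, rfl⟩ := mem_boundaryAction_iff.1 hψ
    obtain ⟨g', hg', e⟩ := hΓ.subset (mem_image_of_mem _ hg)
    exact mem_boundaryAction_iff.2 ⟨g', hg', conj_boundaryHomeo_eq hh e.symm⟩
  · intro hφ
    obtain ⟨g', hg', rfl⟩ := mem_boundaryAction_iff.1 hφ
    obtain ⟨g, hg, e⟩ := hΓ.superset (mem_image_of_mem _ hg')
    exact ⟨_, mem_boundaryAction_iff.2 ⟨g, hg, rfl⟩, conj_boundaryHomeo_eq hh e⟩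

/-- The lattices are replaced by their conjugates under `a⁻¹` and `b`. -/
theorem IsEquivariantPair.isometry_comp {H : Equiv.Perm HypThree} {h : RSphere ≃ₜ RSphere}
    (hH : IsEquivariantPair H h) (b a : HypThree ≃ᵢ HypThree) :
    IsEquivariantPair (b.toEquiv * H * a.toEquiv) (boundaryHomeo b * h * boundaryHomeo a) := by
  obtain ⟨⟨K, hK, hL⟩, hh, Γ₁, Γ₂, h1, h2, h3, -⟩ := hH
  have hh' : IsBoundaryExtension (b.toEquiv * H * a.toEquiv : Equiv.Perm HypThree)
      (boundaryHomeo b * h * boundaryHomeo a) :=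
    ((isBoundaryExtension_boundaryHomeo b).comp hh).comp (isBoundaryExtension_boundaryHomeo a)
  have h4 : (fun g : HypThree ≃ᵢ HypThree =>
      b.toEquiv * H * a.toEquiv * g.toEquiv * (b.toEquiv * H * a.toEquiv)⁻¹) ''
      (Γ₁.map (MulAut.conj a⁻¹).toMonoidHom : Set (HypThree ≃ᵢ HypThree)) =
      IsometryEquiv.toEquiv '' (Γ₂.map (MulAut.conj b).toMonoidHom : Set _) := by
    have e1 : ∀ g : HypThree ≃ᵢ HypThree, b.toEquiv * H * a.toEquiv *
        (MulAut.conj a⁻¹ g).toEquiv * (b.toEquiv * H * a.toEquiv)⁻¹ =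
        b.toEquiv * (H * g.toEquiv * H⁻¹) * b.toEquiv⁻¹ := fun g => by
      have : (MulAut.conj a⁻¹ g).toEquiv = a.toEquiv⁻¹ * g.toEquiv * a.toEquiv := rfl
      rw [this]
      group
    have e2 : ∀ g : HypThree ≃ᵢ HypThree, (MulAut.conj b g).toEquiv =
        b.toEquiv * g.toEquiv * b.toEquiv⁻¹ := fun g => rfl
    simp only [Subgroup.coe_map, image_image]
    erw [image_congr fun g _ => e1 g, image_congr fun g _ => e2 g]
    rw [← image_image (fun x => b.toEquiv * x * b.toEquiv⁻¹), h3, image_image]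
  refine ⟨⟨K, hK, fun p q => ?_⟩, hh', _, _, h1.conj a⁻¹, h2.conj b, h4,
    image_boundaryAction hh' h4⟩
  have := hL (a p) (a q)
  rw [a.dist_eq] at this
  simpa [b.dist_eq] using this

/-- Cocompactness: up to the lattices, every isometry moves the base point a bounded distance. -/
theorem IsEquivariantPair.exists_renormalization {H : Equiv.Perm HypThree} {h : RSphere ≃ₜ RSphere}
    (hH : IsEquivariantPair H h) : ∃ R : ℝ, ∀ g : HypThree ≃ᵢ HypThree,
      ∃ a c : HypThree ≃ᵢ HypThree, dist (a base) base ≤ R ∧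
        (∀ p, H (g p) = c (H (a p))) ∧
        ∀ ξ, h (boundaryHomeo g ξ) = boundaryHomeo c (h (boundaryHomeo a ξ)) := by
  obtain ⟨-, hh, Γ₁, Γ₂, h1, -, h3, -⟩ := hH
  obtain ⟨K, hK, hcov⟩ := h1.cocompact
  obtain ⟨R, hR⟩ := hK.isBounded.subset_closedBall base
  refine ⟨R, fun g => ?_⟩
  obtain ⟨γ, hγ, hp⟩ := hcov (g base)
  obtain ⟨γ', -, e⟩ := h3.subset (mem_image_of_mem _ hγ)
  have e1 := conj_boundaryHomeo_eq hh e.symm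
  rw [mul_inv_eq_iff_eq_mul] at e1
  have e2 := e.symm
  simp only [mul_inv_eq_iff_eq_mul] at e2
  -- If `γ` brings `g base` into the compact set and `H γ = γ' H`, then `H g = γ'⁻¹ H (γ g)`.
  refine ⟨γ * g, γ'⁻¹, hR hp, fun p => ?_, fun ξ => ?_⟩
  · have := DFunLike.congr_fun e2 (g p)
    simp only [Equiv.Perm.mul_apply, IsometryEquiv.coe_toEquiv] at this
    simp [this]
  · have := DFunLike.congr_fun e1 (boundaryHomeo g ξ)
    rw [boundaryHomeo_mul, boundaryHomeo_inv]
    exact (Homeomorph.symm_apply_eq (boundaryHomeo γ')).2 this |>.symm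

theorem PairEquivalent.trans {H H' H'' : Equiv.Perm HypThree} {h h' h'' : RSphere ≃ₜ RSphere}
    (h1 : PairEquivalent H h H' h') (h2 : PairEquivalent H' h' H'' h'') :
    PairEquivalent H h H'' h'' := by
  obtain ⟨f, g, φ, ψ, hf, hg, e, e'⟩ := h1
  obtain ⟨f', g', φ', ψ', hf', hg', k, k'⟩ := h2
  refine ⟨f' * f, g * g', φ' * φ, ψ * ψ', hf'.comp hf, hg.comp hg', fun p => ?_, fun ξ => ?_⟩
  · rw [k, e]; rfl
  · rw [k', e']; rfl

theorem pairEquivalent_isometry_comp (H : Equiv.Perm HypThree) (h : RSphere ≃ₜ RSphere)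
    (b a : HypThree ≃ᵢ HypThree) :
    PairEquivalent H h (b.toEquiv * H * a.toEquiv) (boundaryHomeo b * h * boundaryHomeo a) :=
  ⟨b, a, boundaryHomeo b, boundaryHomeo a, isBoundaryExtension_boundaryHomeo b,
    isBoundaryExtension_boundaryHomeo a, fun _ => rfl, fun _ => rfl⟩

theorem IsBL.continuous {H : Equiv.Perm HypThree} (hH : IsBL H) : Continuous H := by
  obtain ⟨K, hK, h⟩ := hH
  exact (LipschitzWith.of_dist_le' fun p q => (h p q).2).continuous

/-- A tame sequence of pairs `(f H g, f h g)` subconverges to a pair of the same kind. -/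
theorem IsEquivariantPair.exists_subseq_tendsto {H : Equiv.Perm HypThree} {h : RSphere ≃ₜ RSphere}
    (hH : IsEquivariantPair H h) (f g : ℕ → HypThree ≃ᵢ HypThree)
    (htame : Bornology.IsBounded (range fun n => f n (H (g n base)))) :
    ∃ (b a : HypThree ≃ᵢ HypThree) (s : ℕ → ℕ), StrictMono s ∧
      TendstoContinuously (fun n p => f (s n) (H (g (s n) p))) (b.toEquiv * H * a.toEquiv :
        Equiv.Perm HypThree) ∧
      TendstoContinuously (fun n ξ => boundaryHomeo (f (s n)) (h (boundaryHomeo (g (s n)) ξ)))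
        (boundaryHomeo b * h * boundaryHomeo a : RSphere ≃ₜ RSphere) := by
  obtain ⟨R, hR⟩ := hH.exists_renormalization
  choose a c ha hc hc' using fun n => hR (g n)
  obtain ⟨K, hK, hL⟩ := hH.1
  obtain ⟨B, hB⟩ := htame.subset_closedBall base
  -- The point `H (a n base)` is within `K * R` of `H base`, and `f n * c n` maps it to the tame
  -- point `f n (H (g n base))`.
  have hb : ∀ n, dist ((f n * c n) base) base ≤ (dist (H base) base + K * R) + B := fun n => by
    have h1 : dist (f n (H (g n base))) base ≤ B := hB ⟨n, rfl⟩
    refine (dist_triangle _ (f n (H (g n base))) _).trans (add_le_add ?_ h1)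
    rw [hc, ← IsometryEquiv.mul_apply, IsometryEquiv.dist_eq, dist_comm]
    refine (dist_triangle_left _ _ (H base)).trans ?_
    rw [add_comm]
    refine add_le_add le_rfl ((hL _ _).2.trans ?_)
    rw [dist_comm]
    gcongr
    exact ha n
  obtain ⟨a', s, hs, h1⟩ := exists_subseq_linearize_tendsto ha
  obtain ⟨b', s', hs', h2⟩ := exists_subseq_linearize_tendsto fun n => hb (s n)
  have h1' := h1.comp hs'.tendsto_atTop
  refine ⟨b', a', s ∘ s', hs.comp hs', ?_, ?_⟩
  · have := ((tendstoContinuously_of_linearize h2).comp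
      (TendstoContinuously.const hH.1.continuous)).comp
      (tendstoContinuously_of_linearize (a := fun n => a (s (s' n))) h1')
    refine (congrArg₂ TendstoContinuously ?_ rfl).mp this
    funext n p
    simp [hc]
  · have := ((tendstoContinuously_boundaryHomeo h2).comp
      (TendstoContinuously.const h.continuous)).comp
      (tendstoContinuously_boundaryHomeo (a := fun n => a (s (s' n))) h1')
    refine (congrArg₂ TendstoContinuously ?_ rfl).mp this
    funext n ξ
    simp [hc', boundaryHomeo_mul]


/-! ### Similarities, separation of ideal points and cross ratios. -/

/-- The orientation preserving affine homeomorphism `z ↦ a z + b`. -/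
noncomputable def affineHomeo (a b : ℂ) (ha : a ≠ 0) : ℂ ≃ₜ ℂ :=
  (Homeomorph.mulLeft₀ a ha).trans (Homeomorph.addRight b)

@[simp] theorem affineHomeo_apply (a b : ℂ) (ha : a ≠ 0) (z : ℂ) :
    affineHomeo a b ha z = a * z + b := rfl

namespace HypThree

/-- The similarity `(z, t) ↦ (a z + b, |a| t)`. -/
noncomputable def similarity (a b : ℂ) (ha : a ≠ 0) : HypThree ≃ᵢ HypThree where
  toFun p := ⟨a * p.z + b, ‖a‖ * p.t, mul_pos (norm_pos_iff.2 ha) p.pos⟩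
  invFun p := ⟨a⁻¹ * (p.z - b), ‖a‖⁻¹ * p.t, mul_pos (inv_pos.2 (norm_pos_iff.2 ha)) p.pos⟩
  left_inv p := by
    have := norm_ne_zero_iff.2 ha
    ext <;> simp [ha]
  right_inv p := by
    have := norm_ne_zero_iff.2 ha
    ext <;> simp [ha]
  isometry_toFun := by
    refine Isometry.of_dist_eq fun p q => ?_
    have h0 := norm_pos_iff.2 ha
    have hp := p.pos
    have hq := q.pos
    have key : ∀ p q : HypThree, mform p.hyperboloid q.hyperboloid =
        (‖p.z - q.z‖ ^ 2 + p.t ^ 2 + q.t ^ 2) / (2 * p.t * q.t) := fun p q => by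
      have hp := p.pos
      have hq := q.pos
      simp only [mform_apply, hyperboloid, norm_sq_eq]
      simp
      field_simp
      ring
    rw [dist_eq_iff_mform, key, key]
    simp only [add_sub_add_right_eq_sub, ← mul_sub, norm_mul]
    field_simp

theorem isBoundaryExtension_similarity (a b : ℂ) (ha : a ≠ 0) :
    IsBoundaryExtension (similarity a b ha) (affineHomeo a b ha).onePointCongr := by
  intro ξ
  let G : ℂ × ℝ ≃ₜ ℂ × ℝ := (affineHomeo a b ha).prodCongr
    (Homeomorph.mulLeft₀ ‖a‖ (norm_ne_zero_iff.2 ha))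
  have h1 : RSphere.toBall ((affineHomeo a b ha).onePointCongr ξ) = G.onePointCongr ξ.toBall := by
    induction ξ using OnePoint.rec with
    | infty => rfl
    | coe z =>
      simp only [Homeomorph.onePointCongr_apply, RSphere.toBall, OnePoint.map_some]
      exact congrArg _ (Prod.ext rfl (mul_zero ‖a‖).symm)
  rw [h1]
  exact (G.onePointCongr.continuous.tendsto _).comp tendsto_comap

theorem boundaryHomeo_similarity (a b : ℂ) (ha : a ≠ 0) :
    boundaryHomeo (similarity a b ha) = (affineHomeo a b ha).onePointCongr :=
  (isBoundaryExtension_boundaryHomeo _).unique (isBoundaryExtension_similarity a b ha)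

theorem boundaryHomeo_similarity_coe (a b : ℂ) (ha : a ≠ 0) (z : ℂ) :
    boundaryHomeo (similarity a b ha) (z : OnePoint ℂ) = ((a * z + b : ℂ) : OnePoint ℂ) := by
  rw [boundaryHomeo_similarity]; rfl

theorem boundaryHomeo_similarity_infty (a b : ℂ) (ha : a ≠ 0) :
    boundaryHomeo (similarity a b ha) OnePoint.infty = OnePoint.infty := by
  rw [boundaryHomeo_similarity]; rfl

theorem homothety_eq_similarity (c : ℂ) (r : ℝ) (hr : 0 < r) (p : HypThree) :
    homothety c r hr p =
      similarity (r : ℂ) (c - r * c) (Complex.ofReal_ne_zero.2 hr.ne') p := by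
  refine HypThree.ext ?_ ?_
  · change AffineMap.homothety c r p.z = r * p.z + (c - r * c)
    rw [AffineMap.homothety_apply]
    simp
    ring
  · change r * p.t = ‖(r : ℂ)‖ * p.t
    rw [Complex.norm_real, Real.norm_of_nonneg hr.le]

/-- A bound for the Lorentz products of normalized light vectors. -/
theorem exists_mform_toCone_le : ∃ B : ℝ, 1 ≤ B ∧
    ∀ ξ η : RSphere, mform ξ.toCone η.toCone ≤ B := by
  have h1 : Continuous fun x : RSphere × RSphere => mform x.1.toCone x.2.toCone :=
    continuous_mform.comp ((RSphere.continuous_toCone.comp continuous_fst).prodMk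
      (RSphere.continuous_toCone.comp continuous_snd))
  obtain ⟨B, hB⟩ := isCompact_univ.exists_bound_of_continuousOn h1.continuousOn
  exact ⟨max B 1, le_max_right _ _, fun ξ η =>
    (le_abs_self _).trans ((hB (ξ, η) (mem_univ _)).trans (le_max_left _ _))⟩

theorem exists_mtrace_linearize_le (R : ℝ) : ∃ M : ℝ, 0 < M ∧
    ∀ a : HypThree ≃ᵢ HypThree, dist (a base) base ≤ R →
      ∀ ξ : RSphere, mtrace (linearize a ξ.toCone) ≤ M := by
  obtain ⟨B, hB⟩ := isCompact_univ.exists_bound_of_continuousOn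
    RSphere.continuous_toCone.continuousOn
  refine ⟨‖mtrace‖ * ((∑ i, ‖coord i‖ * (2 * Real.cosh (dist (frame i) base + R))) * |B|) + 1,
    ?_, fun a ha ξ => ?_⟩
  · have := fun i => Real.cosh_pos (dist (frame i) base + R)
    have : 0 ≤ ∑ i, ‖coord i‖ * (2 * Real.cosh (dist (frame i) base + R)) :=
      Finset.sum_nonneg fun i _ => mul_nonneg (norm_nonneg _) (by linarith [this i])
    positivity
  · have h1 : ‖linearize a ξ.toCone‖ ≤
        (∑ i, ‖coord i‖ * (2 * Real.cosh (dist (frame i) base + R))) * |B| :=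
      ((linearize a).le_opNorm _).trans (mul_le_mul (norm_linearize_le ha)
        ((hB ξ (mem_univ _)).trans (le_abs_self B)) (norm_nonneg _)
        ((norm_nonneg _).trans (norm_linearize_le ha)))
    have h2 := (le_abs_self _).trans (mtrace.le_opNorm (linearize a ξ.toCone))
    refine h2.trans ((mul_le_mul_of_nonneg_left h1 (norm_nonneg _)).trans ?_)
    linarith

/-- Isometries of bounded displacement, followed by a fixed homeomorphism, keep separated ideal
points uniformly separated. -/
theorem exists_le_mform_image (k : RSphere ≃ₜ RSphere) (R : ℝ) {δ : ℝ} (hδ : 0 < δ) :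
    ∃ ε : ℝ, 0 < ε ∧ ∀ a : HypThree ≃ᵢ HypThree, dist (a base) base ≤ R → ∀ ξ η : RSphere,
      δ ≤ mform ξ.toCone η.toCone →
      ε ≤ mform (k (boundaryHomeo a ξ)).toCone (k (boundaryHomeo a η)).toCone := by
  obtain ⟨M, hM, h⟩ := exists_mtrace_linearize_le R
  have hc : ∀ k : RSphere ≃ₜ RSphere,
      Continuous fun x : RSphere × RSphere => mform (k x.1).toCone (k x.2).toCone := fun k =>
    continuous_mform.comp
      ((RSphere.continuous_toCone.comp (k.continuous.comp continuous_fst)).prodMk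
        (RSphere.continuous_toCone.comp (k.continuous.comp continuous_snd)))
  -- The trace factors are at most `M`, so a product at least `δ` stays at least `δ / (M * M)` after
  -- applying `a`. On this compact set of pairs of distinct points the product of the images under
  -- `k` has a positive lower bound.
  have hK : IsCompact {x : RSphere × RSphere | δ / (M * M) ≤ mform x.1.toCone x.2.toCone} :=
    (isClosed_le continuous_const (hc 1)).isCompact
  obtain ⟨ε, hε, h1⟩ := hK.exists_forall_le' (hc k).continuousOn (a := 0) fun x hx => by
    refine RSphere.mform_toCone_pos fun e => ?_
    have hx' : δ / (M * M) ≤ mform x.1.toCone x.2.toCone := hx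
    rw [k.injective e, RSphere.mform_toCone_self] at hx'
    exact absurd hx' (not_le.2 (by positivity))
  refine ⟨ε, hε, fun a ha ξ η hξη => h1 (boundaryHomeo a ξ, boundaryHomeo a η) ?_⟩
  change δ / (M * M) ≤ _
  rw [mform_boundaryHomeo]
  have h2 := mtrace_linearize_toCone_pos a ξ
  have h3 := mtrace_linearize_toCone_pos a η
  exact div_le_div₀ (hδ.le.trans hξη) hξη (mul_pos h2 h3)
    (mul_le_mul (h a ha ξ) (h a ha η) h3.le hM.le)

/-- The cross ratio is invariant under isometries. -/
theorem cross_ratio_boundaryHomeo (c : HypThree ≃ᵢ HypThree) (p q r s : RSphere) :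
    mform (boundaryHomeo c p).toCone (boundaryHomeo c q).toCone *
        mform (boundaryHomeo c r).toCone (boundaryHomeo c s).toCone *
        (mform p.toCone s.toCone * mform r.toCone q.toCone) =
      mform (boundaryHomeo c p).toCone (boundaryHomeo c s).toCone *
        mform (boundaryHomeo c r).toCone (boundaryHomeo c q).toCone *
        (mform p.toCone q.toCone * mform r.toCone s.toCone) := by
  have h1 := (mtrace_linearize_toCone_pos c p).ne'
  have h2 := (mtrace_linearize_toCone_pos c q).ne'
  have h3 := (mtrace_linearize_toCone_pos c r).ne'
  have h4 := (mtrace_linearize_toCone_pos c s).ne'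
  simp only [mform_boundaryHomeo]
  field_simp

/-- Two light vectors control a vector of the cone. -/
theorem mform_add_mform_ge (ξ η : RSphere) (p : HypThree) :
    mform ξ.toCone η.toCone / 2 * mtrace p.hyperboloid ≤
      mform ξ.toCone p.hyperboloid + mform η.toCone p.hyperboloid := by
  have hT := mtrace_hyperboloid_pos p
  have h1 := RSphere.mform_toCone_self ξ
  have h2 := RSphere.mform_toCone_self η
  have h3 := RSphere.mtrace_toCone ξ
  have h4 := RSphere.mtrace_toCone η
  have h5 := mform_hyperboloid_self p
  generalize ξ.toCone = x at *
  generalize η.toCone = y at *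
  generalize p.hyperboloid = P at *
  obtain ⟨a, z, c⟩ := x
  obtain ⟨a', z', c'⟩ := y
  obtain ⟨A, Z, C⟩ := P
  simp only [mform_apply, mtrace_apply] at *
  generalize z.re = x1 at *
  generalize z.im = x2 at *
  generalize z'.re = y1 at *
  generalize z'.im = y2 at *
  generalize Z.re = X1 at *
  generalize Z.im = X2 at *
  obtain rfl : c = 1 - a := by linarith
  obtain rfl : c' = 1 - a' := by linarith
  obtain ⟨T, rfl⟩ : ∃ T, C = T - A := ⟨A + C, by ring⟩
  have hT' : 0 < T := by linarith
  refine le_of_mul_le_mul_left ?_ (show 0 < 8 * T by linarith)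
  have e1 : x1 ^ 2 + x2 ^ 2 = a * (1 - a) := by linarith
  have e2 : y1 ^ 2 + y2 ^ 2 = a' * (1 - a') := by linarith
  have e3 : X1 ^ 2 + X2 ^ 2 = A * (T - A) - 1 := by linarith
  have e1' := congrArg (T ^ 2 * ·) e1
  have e2' := congrArg (T ^ 2 * ·) e2
  -- With `x = (1, n₁) / 2`, `y = (1, n₂) / 2`, `P = T (1, N) / 2` in ball coordinates, the squared
  -- terms are the components of `n₁ + n₂ - 2 N` times `T / 2`, and `|N| ≤ 1`.
  nlinarith [sq_nonneg ((a + a' - 1) * T - (2 * A - T)), sq_nonneg ((x1 + y1) * T - 2 * X1),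
    sq_nonneg ((x2 + y2) * T - 2 * X2)]

/-- An isometry that moves a separated triple of ideal points to a separated triple has bounded
displacement. -/
theorem exists_dist_base_le {ε : ℝ} (hε : 0 < ε) : ∃ R : ℝ, ∀ (b : HypThree ≃ᵢ HypThree)
    (ξ η ζ : RSphere), ε ≤ mform ξ.toCone η.toCone →
      ε ≤ mform (boundaryHomeo b ξ).toCone (boundaryHomeo b η).toCone →
      ε ≤ mform (boundaryHomeo b ξ).toCone (boundaryHomeo b ζ).toCone →
      ε ≤ mform (boundaryHomeo b η).toCone (boundaryHomeo b ζ).toCone →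
      ε ≤ mform ξ.toCone ζ.toCone → ε ≤ mform η.toCone ζ.toCone →
      dist (b base) base ≤ R := by
  obtain ⟨B, hB1, hB⟩ := exists_mform_toCone_le
  -- The traces `l1`, `l2` will be at most `(B / ε) ^ 3 + 1`. Then `mform_add_mform_ge` bounds `ε *
  -- cosh d` by `(l1 + l2) / 2`, and `d ≤ 2 * cosh d`.
  refine ⟨2 * ((B / ε) ^ 3 + 1) / ε, fun b ξ η ζ h12 k12 k13 k23 h13 h23 => ?_⟩
  have p1 := mtrace_linearize_toCone_pos b ξ
  have p2 := mtrace_linearize_toCone_pos b η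
  have p3 := mtrace_linearize_toCone_pos b ζ
  have hB0 : 0 < B := by linarith
  have key := mform_add_mform_ge ξ η (b.symm base)
  have e1 := mtrace_linearize b ξ.toCone
  have e2 := mtrace_linearize b η.toCone
  set l1 := mtrace (linearize b ξ.toCone)
  set l2 := mtrace (linearize b η.toCone)
  set l3 := mtrace (linearize b ζ.toCone)
  have upper : ∀ {x y : RSphere}, 0 < mtrace (linearize b x.toCone) →
      0 < mtrace (linearize b y.toCone) →
      ε ≤ mform (boundaryHomeo b x).toCone (boundaryHomeo b y).toCone →
      mtrace (linearize b x.toCone) * mtrace (linearize b y.toCone) ≤ B / ε := by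
    intro x y hx hy h
    rw [mform_boundaryHomeo, le_div_iff₀ (mul_pos hx hy)] at h
    rw [le_div_iff₀ hε]
    linarith [hB x y]
  have lower : ∀ {x y : RSphere}, 0 < mtrace (linearize b x.toCone) →
      0 < mtrace (linearize b y.toCone) → ε ≤ mform x.toCone y.toCone →
      ε / B ≤ mtrace (linearize b x.toCone) * mtrace (linearize b y.toCone) := by
    intro x y hx hy h
    have h' := hB (boundaryHomeo b x) (boundaryHomeo b y)
    rw [mform_boundaryHomeo, div_le_iff₀ (mul_pos hx hy)] at h'
    rw [div_le_iff₀ hB0]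
    linarith
  have u12 : l1 * l2 ≤ B / ε := upper p1 p2 k12
  have u13 : l1 * l3 ≤ B / ε := upper p1 p3 k13
  have u23 : l2 * l3 ≤ B / ε := upper p2 p3 k23
  have d13 : ε / B ≤ l1 * l3 := lower p1 p3 h13
  have d23 : ε / B ≤ l2 * l3 := lower p2 p3 h23
  have hr : 0 < B / ε := by positivity
  -- Pairwise products determine a single factor: `x ^ 2 = (x y) (x l3) / (y l3)`.
  have sq : ∀ {x y : ℝ}, 0 < x → 0 < y → x * y ≤ B / ε → x * l3 ≤ B / ε → ε / B ≤ y * l3 →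
      x ≤ (B / ε) ^ 3 + 1 := by
    intro x y hx hy hxy hx3 hy3
    have h1 : x ^ 2 * (y * l3) ≤ (B / ε) ^ 2 := by
      have := mul_le_mul hxy hx3 (by positivity) hr.le
      nlinarith
    have h2 : x ^ 2 * (ε / B) ≤ (B / ε) ^ 2 :=
      (mul_le_mul_of_nonneg_left hy3 (sq_nonneg x)).trans h1
    have h3 : x ^ 2 ≤ (B / ε) ^ 3 := by
      have h4 : ε / B * (B / ε) = 1 := by field_simp
      have := mul_le_mul_of_nonneg_right h2 hr.le
      rw [mul_assoc, h4] at this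
      linarith [pow_succ (B / ε) 2]
    nlinarith [sq_nonneg (x - 1)]
  have m1 := sq p1 p2 u12 u13 d23
  have m2 := sq p2 p1 (by rwa [mul_comm]) u23 d13
  have hd : mtrace (b.symm base).hyperboloid = 2 * Real.cosh (dist (b base) base) := by
    rw [mtrace_eq_mform, mform_hyperboloid, ← b.dist_eq, b.apply_symm_apply, dist_comm]
  rw [hd] at key
  have h5 : dist (b base) base ≤ 2 * Real.cosh (dist (b base) base) := by
    have h6 := Real.add_one_le_exp (dist (b base) base)
    have h7 := Real.exp_pos (-dist (b base) base)
    rw [Real.cosh_eq]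
    linarith
  refine h5.trans ?_
  rw [le_div_iff₀ hε]
  have h8 := Real.cosh_pos (dist (b base) base)
  nlinarith

end HypThree

/-! ### Quasisymmetry of the boundary map. -/

theorem exists_onePointCongr_eq {k : RSphere ≃ₜ RSphere} (hk : k OnePoint.infty = OnePoint.infty) :
    ∃ h : ℂ ≃ₜ ℂ, h.onePointCongr = k := by
  have h1 : ∀ k : RSphere ≃ₜ RSphere, k OnePoint.infty = OnePoint.infty →
      ∃ f : ℂ → ℂ, Continuous f ∧ ∀ z : ℂ, ((f z : ℂ) : OnePoint ℂ) = k (z : OnePoint ℂ) := by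
    intro k hk
    have h2 : ∀ z : ℂ, ∃ w : ℂ, (w : OnePoint ℂ) = k (z : OnePoint ℂ) := fun z => by
      rw [← OnePoint.ne_infty_iff_exists, ← hk]
      exact fun h => OnePoint.coe_ne_infty z (k.injective h)
    choose f hf using h2
    refine ⟨f, ?_, hf⟩
    rw [OnePoint.isOpenEmbedding_coe.isInducing.continuous_iff]
    exact (k.continuous.comp OnePoint.continuous_coe).congr fun z => (hf z).symm
  obtain ⟨f, hf, hfk⟩ := h1 k hk
  obtain ⟨g, hg, hgk⟩ := h1 k.symm (by rw [Homeomorph.symm_apply_eq, hk])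
  refine ⟨⟨⟨f, g, fun z => ?_, fun z => ?_⟩, hf, hg⟩, ?_⟩
  · apply OnePoint.coe_injective
    rw [hgk, hfk, Homeomorph.symm_apply_apply]
  · apply OnePoint.coe_injective
    rw [hfk, hgk, Homeomorph.apply_symm_apply]
  · ext ξ
    induction ξ using OnePoint.rec with
    | infty => exact hk.symm
    | coe z => exact hfk z

theorem Homeomorph.onePointCongr_coe (h : ℂ ≃ₜ ℂ) (z : ℂ) :
    h.onePointCongr (z : OnePoint ℂ) = ((h z : ℂ) : OnePoint ℂ) := rfl

theorem Homeomorph.onePointCongr_infty (h : ℂ ≃ₜ ℂ) :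
    h.onePointCongr OnePoint.infty = OnePoint.infty := rfl

/-- The boundary map of an equivariant pair is quasisymmetric. -/
theorem IsEquivariantPair.quasisymmetric {H : Equiv.Perm HypThree} {h : ℂ ≃ₜ ℂ}
    (hH : IsEquivariantPair H h.onePointCongr) : ∃ C : ℝ, 0 < C ∧ ∀ z u u' : ℂ,
      ‖u‖ ≤ 2 * ‖u'‖ → ‖h (z + u) - h z‖ ≤ C * ‖h (z + u') - h z‖ := by
  obtain ⟨R, hR⟩ := hH.exists_renormalization
  obtain ⟨B, hB1, hB⟩ := exists_mform_toCone_le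
  -- The products used are `1 / 4` for the points `1`, `0`, and at least `1 / (2 * (1 + 2 ^ 2)) = 1
  -- / 10` for `u / u'` and `∞`.
  obtain ⟨ε, hε, hsep⟩ := exists_le_mform_image h.onePointCongr R (δ := 1 / 10) (by norm_num)
  refine ⟨B / ε, by positivity, fun z u u' hu => ?_⟩
  rcases eq_or_ne u' 0 with rfl | hu'
  · have : u = 0 := by simpa using hu
    simp [this]
  obtain ⟨a, c, ha, -, hc⟩ := hR (similarity u' z hu')
  have hpt : ∀ w : ℂ, ((h (z + u' * w) : ℂ) : OnePoint ℂ) = boundaryHomeo c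
      (h.onePointCongr (boundaryHomeo a (w : OnePoint ℂ))) := fun w => by
    rw [← hc, boundaryHomeo_similarity_coe, Homeomorph.onePointCongr_coe, add_comm z]
  have hinf : (OnePoint.infty : OnePoint ℂ) = boundaryHomeo c
      (h.onePointCongr (boundaryHomeo a OnePoint.infty)) := by
    rw [← hc, boundaryHomeo_similarity_infty, Homeomorph.onePointCongr_infty]
  have s1 := hsep a ha ((1 : ℂ) : OnePoint ℂ) ((0 : ℂ) : OnePoint ℂ) (by
    rw [RSphere.mform_toCone_coe]; norm_num)
  have s2 := hsep a ha ((u / u' : ℂ) : OnePoint ℂ) OnePoint.infty (by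
    rw [RSphere.mform_toCone_infty]
    have h1 : ‖u / u'‖ ≤ 2 := by
      rw [norm_div, div_le_iff₀ (norm_pos_iff.2 hu')]
      exact hu
    refine one_div_le_one_div_of_le (by positivity) ?_
    nlinarith [norm_nonneg (u / u')])
  -- With `∞` among the four points, the cross ratio of the images is the squared ratio of the two
  -- displacements. It also equals the cross ratio before applying `c`, which is at most `(B / ε) ^
  -- 2`.
  have key := cross_ratio_boundaryHomeo c
    (h.onePointCongr (boundaryHomeo a ((u / u' : ℂ) : OnePoint ℂ)))
    (h.onePointCongr (boundaryHomeo a ((0 : ℂ) : OnePoint ℂ)))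
    (h.onePointCongr (boundaryHomeo a ((1 : ℂ) : OnePoint ℂ)))
    (h.onePointCongr (boundaryHomeo a OnePoint.infty))
  rw [← hpt, ← hpt, ← hpt, ← hinf, mul_div_cancel₀ _ hu', mul_one, mul_zero, add_zero,
    RSphere.mform_toCone_coe, RSphere.mform_toCone_coe, RSphere.mform_toCone_infty,
    RSphere.mform_toCone_infty] at key
  have b1 := hB (h.onePointCongr (boundaryHomeo a ((u / u' : ℂ) : OnePoint ℂ)))
    (h.onePointCongr (boundaryHomeo a ((0 : ℂ) : OnePoint ℂ)))
  have b2 := hB (h.onePointCongr (boundaryHomeo a ((1 : ℂ) : OnePoint ℂ)))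
    (h.onePointCongr (boundaryHomeo a OnePoint.infty))
  have n1 := RSphere.mform_toCone_nonneg
    (h.onePointCongr (boundaryHomeo a ((1 : ℂ) : OnePoint ℂ)))
    (h.onePointCongr (boundaryHomeo a OnePoint.infty))
  generalize mform (RSphere.toCone (h.onePointCongr (boundaryHomeo a ((u / u' : ℂ) : OnePoint ℂ))))
    (RSphere.toCone (h.onePointCongr (boundaryHomeo a OnePoint.infty))) = m1 at *
  generalize mform (RSphere.toCone (h.onePointCongr (boundaryHomeo a ((1 : ℂ) : OnePoint ℂ))))
    (RSphere.toCone (h.onePointCongr (boundaryHomeo a ((0 : ℂ) : OnePoint ℂ)))) = m2 at *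
  generalize mform (RSphere.toCone (h.onePointCongr (boundaryHomeo a ((u / u' : ℂ) : OnePoint ℂ))))
    (RSphere.toCone (h.onePointCongr (boundaryHomeo a ((0 : ℂ) : OnePoint ℂ)))) = m3 at *
  generalize mform (RSphere.toCone (h.onePointCongr (boundaryHomeo a ((1 : ℂ) : OnePoint ℂ))))
    (RSphere.toCone (h.onePointCongr (boundaryHomeo a OnePoint.infty))) = m4 at *
  have q0 : (1 + ‖h z‖ ^ 2) ≠ 0 := by positivity
  have q1 : (1 + ‖h (z + u)‖ ^ 2) ≠ 0 := by positivity
  have q2 : (1 + ‖h (z + u')‖ ^ 2) ≠ 0 := by positivity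
  have key' : ‖h (z + u) - h z‖ ^ 2 * (m1 * m2) = ‖h (z + u') - h z‖ ^ 2 * (m3 * m4) := by
    field_simp at key
    linarith
  rw [div_mul_eq_mul_div, le_div_iff₀ hε, ← abs_of_nonneg (norm_nonneg (h (z + u) - h z)),
    ← abs_of_pos hε, ← abs_mul]
  refine abs_le_of_sq_le_sq ?_ (by positivity)
  have f1 : ε * ε ≤ m1 * m2 := mul_le_mul s2 s1 hε.le (hε.le.trans s2)
  have f2 : m3 * m4 ≤ B * B := mul_le_mul b1 b2 n1 (by linarith)
  nlinarith [mul_le_mul_of_nonneg_left f1 (sq_nonneg ‖h (z + u) - h z‖),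
    mul_le_mul_of_nonneg_left f2 (sq_nonneg ‖h (z + u') - h z‖)]

/-! ### Tameness and convergence of zoom sequences. -/

theorem exists_pos_le_of_tendsto {u : ℕ → ℝ} {L : ℝ} (hu : Tendsto u atTop (𝓝 L)) (hL : 0 < L)
    (hpos : ∀ n, 0 < u n) : ∃ ε : ℝ, 0 < ε ∧ ∀ n, ε ≤ u n := by
  obtain ⟨ε, hε, h⟩ := hu.isCompact_insert_range.exists_forall_le' continuousOn_id (a := 0) (by
    rintro _ (rfl | ⟨n, rfl⟩)
    exacts [hL, hpos n])
  exact ⟨ε, hε, fun n => h _ (mem_insert_of_mem _ (mem_range_self n))⟩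

section Zoom

/-- The isometry that zooms in at `z`. -/
noncomputable def zoomIn (z : ℂ) (n : ℕ) : HypThree ≃ᵢ HypThree :=
  similarity ((1 / ((n : ℝ) + 1) : ℝ) : ℂ) (z - ((1 / ((n : ℝ) + 1) : ℝ) : ℂ) * z)
    (Complex.ofReal_ne_zero.2 (one_div_pos.2 n.cast_add_one_pos).ne')

/-- The isometry that zooms out from `z`. -/
noncomputable def zoomOut (z : ℂ) (n : ℕ) : HypThree ≃ᵢ HypThree :=
  similarity (((n : ℝ) + 1 : ℝ) : ℂ) (z - (((n : ℝ) + 1 : ℝ) : ℂ) * z)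
    (Complex.ofReal_ne_zero.2 n.cast_add_one_pos.ne')

theorem zoomHyp_eq (H : Equiv.Perm HypThree) (h : ℂ ≃ₜ ℂ) (z : ℂ) (n : ℕ) (p : HypThree) :
    zoomHyp H h z n p = zoomOut (h z) n (H (zoomIn z n p)) := by
  rw [zoomHyp, homothety_eq_similarity, homothety_eq_similarity]
  rfl

theorem zoomPlane_eq (h : ℂ ≃ₜ ℂ) (z : ℂ) (n : ℕ) (u : ℂ) :
    zoomPlane h z n u = ((n : ℝ) + 1) • (h (z + (1 / ((n : ℝ) + 1) : ℝ) • (u - z)) - h z) + h z := by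
  rw [zoomPlane, AffineMap.homothety_apply, AffineMap.homothety_apply]
  simp [add_comm]

theorem onePoint_map_zoomPlane (h : ℂ ≃ₜ ℂ) (z : ℂ) (n : ℕ) (ξ : RSphere) :
    OnePoint.map (zoomPlane h z n) ξ =
      boundaryHomeo (zoomOut (h z) n) (h.onePointCongr (boundaryHomeo (zoomIn z n) ξ)) := by
  induction ξ using OnePoint.rec with
  | infty =>
    rw [zoomIn, boundaryHomeo_similarity_infty, Homeomorph.onePointCongr_infty, zoomOut,
      boundaryHomeo_similarity_infty]
    rfl
  | coe u =>
    rw [zoomIn, boundaryHomeo_similarity_coe, Homeomorph.onePointCongr_coe, zoomOut,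
      boundaryHomeo_similarity_coe, OnePoint.map_some, zoomPlane_eq]
    congr 1
    have : (((1 / ((n : ℝ) + 1) : ℝ) : ℂ) * u + (z - ((1 / ((n : ℝ) + 1) : ℝ) : ℂ) * z)) =
        z + (1 / ((n : ℝ) + 1) : ℝ) • (u - z) := by
      rw [Complex.real_smul]; ring
    rw [this, Complex.real_smul]
    ring

/-- Zooming in at a point with a nonzero directional derivative is tame. -/
theorem IsEquivariantPair.isTame {H : Equiv.Perm HypThree} {h : ℂ ≃ₜ ℂ}
    (hH : IsEquivariantPair H h.onePointCongr) {z v w : ℂ} (hv : v ≠ 0) (hw : w ≠ 0)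
    (hd : Tendsto (fun n : ℕ => zoomPlane h z n (z + v)) atTop (𝓝 (h z + w))) :
    IsTame (zoomHyp H h z) := by
  obtain ⟨R, hR⟩ := hH.exists_renormalization
  choose a c ha hc hc' using fun n => hR (zoomIn z n)
  obtain ⟨K, hK, hL⟩ := hH.1
  have hc'' : ∀ n ξ, boundaryHomeo (zoomOut (h z) n * c n)
      (h.onePointCongr (boundaryHomeo (a n) ξ)) = OnePoint.map (zoomPlane h z n) ξ := fun n ξ => by
    rw [onePoint_map_zoomPlane, hc', boundaryHomeo_mul]
    rfl
  have hz : ∀ n, zoomPlane h z n z = h z := fun n => by rw [zoomPlane_eq]; simp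
  have hne : ∀ n, zoomPlane h z n (z + v) ≠ h z := fun n => by
    rw [zoomPlane_eq, add_sub_cancel_left]
    have h0 : (n : ℝ) + 1 ≠ 0 := n.cast_add_one_pos.ne'
    intro e
    rw [add_eq_right, smul_eq_zero, or_iff_right h0, sub_eq_zero] at e
    have := h.injective e
    rw [add_eq_left, smul_eq_zero] at this
    exact this.elim (one_div_ne_zero h0) hv
  have hcc : Continuous fun u : ℂ => RSphere.toCone (u : OnePoint ℂ) :=
    RSphere.continuous_toCone.comp OnePoint.continuous_coe
  have lim : ∀ x : Mink, Tendsto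
      (fun n => mform (RSphere.toCone ((zoomPlane h z n (z + v) : ℂ) : OnePoint ℂ)) x) atTop
      (𝓝 (mform (RSphere.toCone ((h z + w : ℂ) : OnePoint ℂ)) x)) := fun x => by
    have hx : Continuous fun u : ℂ => mform (RSphere.toCone (u : OnePoint ℂ)) x :=
      continuous_mform.comp (hcc.prodMk continuous_const)
    exact (hx.tendsto (h z + w)).comp hd
  obtain ⟨ε₁, hε₁, l1⟩ := exists_pos_le_of_tendsto (lim (RSphere.toCone ((h z : ℂ) : OnePoint ℂ)))
    (RSphere.mform_toCone_pos fun e => hw (by simpa using e))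
    (fun n => RSphere.mform_toCone_pos fun e => hne n (OnePoint.coe_injective e))
  obtain ⟨ε₂, hε₂, l2⟩ := exists_pos_le_of_tendsto (lim (RSphere.toCone OnePoint.infty))
    (RSphere.mform_toCone_pos (OnePoint.coe_ne_infty _))
    (fun n => RSphere.mform_toCone_pos (OnePoint.coe_ne_infty _))
  have l3 := RSphere.mform_toCone_pos (OnePoint.coe_ne_infty (h z))
  have d1 := RSphere.mform_toCone_pos (ξ := (z : OnePoint ℂ)) (η := ((z + v : ℂ) : OnePoint ℂ))
    fun e => hv (by simpa using e)
  have d2 := RSphere.mform_toCone_pos (OnePoint.coe_ne_infty z)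
  have d3 := RSphere.mform_toCone_pos (OnePoint.coe_ne_infty (z + v))
  obtain ⟨ε₃, hε₃, hsep⟩ := exists_le_mform_image h.onePointCongr R (lt_min d1 (lt_min d2 d3))
  obtain ⟨ε, hε, k1, k2, k3, k4⟩ : ∃ ε, 0 < ε ∧ ε ≤ ε₁ ∧ ε ≤ ε₂ ∧ ε ≤ ε₃ ∧
      ε ≤ mform (RSphere.toCone ((h z : ℂ) : OnePoint ℂ)) (RSphere.toCone OnePoint.infty) :=
    ⟨_, lt_min (lt_min hε₁ hε₂) (lt_min hε₃ l3), (min_le_left _ _).trans (min_le_left _ _),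
      (min_le_left _ _).trans (min_le_right _ _), (min_le_right _ _).trans (min_le_left _ _),
      (min_le_right _ _).trans (min_le_right _ _)⟩
  obtain ⟨R', hR'⟩ := exists_dist_base_le hε
  -- The triple `z`, `z + v`, `∞` is separated after `h` and the bounded `a n`; the zoomed map sends
  -- it to `h z`, a point tending to `h z + w`, and `∞`. An isometry matching separated triples has
  -- bounded displacement.
  have hb : ∀ n, dist ((zoomOut (h z) n * c n) base) base ≤ R' := fun n => by
    refine hR' _ (h.onePointCongr (boundaryHomeo (a n) (z : OnePoint ℂ)))
      (h.onePointCongr (boundaryHomeo (a n) ((z + v : ℂ) : OnePoint ℂ)))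
      (h.onePointCongr (boundaryHomeo (a n) OnePoint.infty)) ?_ ?_ ?_ ?_ ?_ ?_
    · exact k3.trans (hsep _ (ha n) _ _ (min_le_left _ _))
    · rw [hc'', hc'', OnePoint.map_some, OnePoint.map_some, hz, mform_comm]
      exact k1.trans (l1 n)
    · rw [hc'', hc'', OnePoint.map_some, OnePoint.map_infty, hz]
      exact k4
    · rw [hc'', hc'', OnePoint.map_some, OnePoint.map_infty]
      exact k2.trans (l2 n)
    · exact k3.trans (hsep _ (ha n) _ _ ((min_le_right _ _).trans (min_le_left _ _)))
    · exact k3.trans (hsep _ (ha n) _ _ ((min_le_right _ _).trans (min_le_right _ _)))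
  intro p
  rw [Metric.isBounded_iff_subset_closedBall base]
  refine ⟨(K * (dist p base + R) + dist (H base) base) + R', ?_⟩
  rintro _ ⟨n, rfl⟩
  rw [Metric.mem_closedBall]
  simp only [zoomHyp_eq, hc]
  rw [← IsometryEquiv.mul_apply]
  refine (dist_triangle _ ((zoomOut (h z) n * c n) base) _).trans (add_le_add ?_ (hb n))
  rw [IsometryEquiv.dist_eq]
  refine (dist_triangle _ (H base) _).trans (add_le_add ((hL _ _).2.trans ?_) le_rfl)
  gcongr
  refine (dist_triangle _ (a n base) _).trans (add_le_add ?_ (ha n))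
  rw [IsometryEquiv.dist_eq]

/-- Zooming in at a point with a nonzero directional derivative subconverges to an equivalent
equivariant pair. -/
theorem IsEquivariantPair.exists_zoomsTo {H : Equiv.Perm HypThree} {h : ℂ ≃ₜ ℂ}
    (hH : IsEquivariantPair H h.onePointCongr) {z v w : ℂ} (hv : v ≠ 0) (hw : w ≠ 0)
    (hd : Tendsto (fun n : ℕ => zoomPlane h z n (z + v)) atTop (𝓝 (h z + w))) :
    ∃ (H' : Equiv.Perm HypThree) (h' : ℂ ≃ₜ ℂ) (s : ℕ → ℕ), StrictMono s ∧
      ZoomsTo H h H' h' ∧ IsEquivariantPair H' h'.onePointCongr ∧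
      PairEquivalent H h.onePointCongr H' h'.onePointCongr ∧
      TendstoContinuously (fun n => zoomPlane h z (s n)) h' := by
  have ht := hH.isTame hv hw hd
  obtain ⟨b, a, s, hs, h1, h2⟩ := hH.exists_subseq_tendsto (zoomOut (h z)) (zoomIn z) (by
    simpa only [zoomHyp_eq] using ht base)
  simp only [← zoomHyp_eq] at h1
  simp only [← onePoint_map_zoomPlane] at h2
  obtain ⟨h', hh'⟩ := exists_onePointCongr_eq
    (k := boundaryHomeo b * h.onePointCongr * boundaryHomeo a)
    (tendsto_nhds_unique (h2.tendsto_apply (tendsto_const_nhds (x := OnePoint.infty)))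
      tendsto_const_nhds)
  rw [← hh'] at h2
  have hH' := hH.isometry_comp b a
  refine ⟨b.toEquiv * H * a.toEquiv, h', s, hs,
    ⟨z, ht, s, hs, fun K hK => h1.tendstoUniformlyOn hH'.1.continuous hK,
      h2.sphereTendstoUniformly h'.onePointCongr.continuous⟩, hh' ▸ hH',
    hh' ▸ pairEquivalent_isometry_comp H h.onePointCongr b a, fun x => ?_⟩
  rw [OnePoint.isOpenEmbedding_coe.isInducing.tendsto_nhds_iff]
  have h3 := h2 (x : OnePoint ℂ)
  rw [OnePoint.nhds_coe_eq] at h3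
  exact h3.comp (tendsto_fst.prodMk (tendsto_map.comp tendsto_snd))

end Zoom

/-! ### The length-area method. -/

open MeasureTheory

theorem sum_measureReal_le {α ι : Type*} [MeasurableSpace α] {μ : Measure α} {s : Finset ι}
    {f : ι → Set α} {S : Set α} (hd : (s : Set ι).PairwiseDisjoint f)
    (hm : ∀ i ∈ s, MeasurableSet (f i)) (hS : ∀ i ∈ s, f i ⊆ S) (hfin : μ S ≠ ⊤) :
    ∑ i ∈ s, μ.real (f i) ≤ μ.real S := by
  rw [← measureReal_biUnion_finset hd hm fun i hi => measure_ne_top_of_subset (hS i hi) hfin]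
  exact measureReal_mono (iUnion₂_subset hS) hfin

/-- `μ` controls the horizontal variation of `k` on squares. -/
def SquareBound (k : ℂ → ℂ) (μ : Measure ℂ) (C : ℝ) : Prop :=
  ∀ x y δ : ℝ, 0 < δ → dist (k ⟨x, y⟩) (k ⟨x + δ, y⟩) ^ 2 ≤
    C * μ.real (Ioo x (x + δ) ×ℂ Ioo y (y + δ))

section Strip

variable {k : ℂ → ℂ} {μ : Measure ℂ} [IsFiniteMeasureOnCompacts μ] {C : ℝ}

theorem measure_rect_ne_top (a b c d : ℝ) : μ (Ioo a b ×ℂ Ioo c d) ≠ ⊤ := by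
  have h1 : IsCompact (Icc a b ×ℂ Icc c d) := isCompact_Icc.reProdIm isCompact_Icc
  exact measure_ne_top_of_subset
    (show Ioo a b ×ℂ Ioo c d ⊆ Icc a b ×ℂ Icc c d from fun z hz =>
      ⟨Ioo_subset_Icc_self hz.1, Ioo_subset_Icc_self hz.2⟩) h1.measure_lt_top.ne

theorem measurableSet_rect (a b c d : ℝ) : MeasurableSet (Ioo a b ×ℂ Ioo c d) :=
  (isOpen_Ioo.reProdIm isOpen_Ioo).measurableSet

theorem disjoint_rect {s s' : Set ℝ} (h : Disjoint s s') (t : Set ℝ) :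
    Disjoint (s ×ℂ t) (s' ×ℂ t) :=
  disjoint_left.2 fun _ hz hz' => disjoint_left.1 h hz.1 hz'.1

theorem rect_subset {s s' t t' : Set ℝ} (h : s ⊆ s') (h' : t ⊆ t') : s ×ℂ t ⊆ s' ×ℂ t' :=
  fun _ hz => ⟨h hz.1, h' hz.2⟩

/-- The length-area estimate for one interval. -/
theorem SquareBound.sq_dist_le (hk : SquareBound k μ C) (hC : 0 ≤ C) {a b y η : ℝ} (hab : a ≤ b)
    (hη : 0 < η) : dist (k ⟨a, y⟩) (k ⟨b, y⟩) ^ 2 ≤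
      ((b - a) / η + 1) * (C * μ.real (Ioo a b ×ℂ Ioo y (y + η))) := by
  rcases hab.eq_or_lt with rfl | hab
  · rw [dist_self, zero_pow two_ne_zero]
    positivity
  -- This is the least number of equal pieces of length at most `η`, so that the square on each
  -- piece fits in the strip. Rounding up costs the `+ 1` in the estimate.
  set n := ⌈(b - a) / η⌉₊
  have hq : 0 < (b - a) / η := div_pos (sub_pos.2 hab) hη
  have hn : 0 < n := Nat.ceil_pos.2 hq
  have hn' : (0 : ℝ) < n := by exact_mod_cast hn
  set δ := (b - a) / n
  have hδ : 0 < δ := div_pos (sub_pos.2 hab) hn'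
  have hδη : δ ≤ η := by
    rw [div_le_iff₀ hn', ← div_le_iff₀' hη]
    exact Nat.le_ceil _
  set t : ℕ → ℝ := fun j => a + j * δ
  have ht : Monotone t := fun i j hij => by
    have : (i : ℝ) ≤ j := by exact_mod_cast hij
    simp only [t]
    gcongr
  have hts : ∀ j, t (j + 1) = t j + δ := fun j => by simp only [t]; push_cast; ring
  have ht0 : t 0 = a := by simp [t]
  have htn : t n = b := by simp only [t, δ]; field_simp; ring
  have h1 : dist (k ⟨a, y⟩) (k ⟨b, y⟩) ≤
      ∑ j ∈ Finset.range n, dist (k ⟨t j, y⟩) (k ⟨t (j + 1), y⟩) := by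
    rw [← ht0, ← htn]
    exact dist_le_range_sum_dist (fun j => k ⟨t j, y⟩) n
  have h2 : (∑ j ∈ Finset.range n, dist (k ⟨t j, y⟩) (k ⟨t (j + 1), y⟩)) ^ 2 ≤
      (∑ j ∈ Finset.range n, (1 : ℝ)) *
        ∑ j ∈ Finset.range n, C * μ.real (Ioo (t j) (t (j + 1)) ×ℂ Ioo y (y + η)) := by
    refine Finset.sum_sq_le_sum_mul_sum_of_sq_le_mul _ (fun _ _ => zero_le_one)
      (fun _ _ => by positivity) fun j _ => ?_
    rw [one_mul, hts]
    refine (hk _ _ _ hδ).trans ?_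
    gcongr
    · exact measure_rect_ne_top _ _ _ _
    · exact rect_subset le_rfl (Ioo_subset_Ioo le_rfl (by linarith))
  have h3 : ∑ j ∈ Finset.range n, μ.real (Ioo (t j) (t (j + 1)) ×ℂ Ioo y (y + η)) ≤
      μ.real (Ioo a b ×ℂ Ioo y (y + η)) := by
    refine sum_measureReal_le (fun i _ j _ hij => ?_) (fun _ _ => measurableSet_rect _ _ _ _)
      (fun j hj => rect_subset (Ioo_subset_Ioo ?_ ?_) le_rfl) (measure_rect_ne_top _ _ _ _)
    · exact disjoint_rect (ht.pairwise_disjoint_on_Ioo_succ hij) _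
    · rw [← ht0]; exact ht (Nat.zero_le _)
    · rw [← htn]; exact ht (Finset.mem_range.1 hj)
  rw [Finset.sum_const, Finset.card_range, nsmul_one, ← Finset.mul_sum] at h2
  refine (pow_le_pow_left₀ dist_nonneg h1 2).trans (h2.trans ?_)
  gcongr
  exact (Nat.ceil_lt_add_one hq.le).le

/-- The length-area estimate for finitely many disjoint intervals. -/
theorem SquareBound.sq_sum_dist_le (hk : SquareBound k μ C) (hC : 0 ≤ C) {y η : ℝ} (hη : 0 < η)
    {E : ℕ × (ℕ → ℝ × ℝ)} (hE : E ∈ AbsolutelyContinuousOnInterval.disjWithin 0 1) :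
    (∑ i ∈ Finset.range E.1, dist (k ⟨(E.2 i).1, y⟩) (k ⟨(E.2 i).2, y⟩)) ^ 2 ≤
      ((∑ i ∈ Finset.range E.1, dist (E.2 i).1 (E.2 i).2) / η + E.1) *
        (C * μ.real (Ioo 0 1 ×ℂ Ioo y (y + η))) := by
  set a : ℕ → ℝ := fun i => min (E.2 i).1 (E.2 i).2
  set b : ℕ → ℝ := fun i => max (E.2 i).1 (E.2 i).2
  have hab : ∀ i, a i ≤ b i := fun i => min_le_max
  have hd : ∀ i, dist (k ⟨(E.2 i).1, y⟩) (k ⟨(E.2 i).2, y⟩) = dist (k ⟨a i, y⟩) (k ⟨b i, y⟩) := by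
    intro i
    rcases le_total (E.2 i).1 (E.2 i).2 with h | h
    · simp only [a, b, min_eq_left h, max_eq_right h]
    · simp only [a, b, min_eq_right h, max_eq_left h, dist_comm]
  have hl : ∀ i, dist (E.2 i).1 (E.2 i).2 = b i - a i := fun i => by
    rw [Real.dist_eq, max_sub_min_eq_abs, abs_sub_comm]
  simp only [hd, hl]
  have h1 := Finset.sum_sq_le_sum_mul_sum_of_sq_le_mul (Finset.range E.1)
    (r := fun i => dist (k ⟨a i, y⟩) (k ⟨b i, y⟩)) (f := fun i => (b i - a i) / η + 1)
    (g := fun i => C * μ.real (Ioo (a i) (b i) ×ℂ Ioo y (y + η)))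
    (fun i _ => by have := sub_nonneg.2 (hab i); positivity) (fun _ _ => by positivity)
    (fun i _ => hk.sq_dist_le hC (hab i) hη)
  rw [Finset.sum_add_distrib, Finset.sum_const, Finset.card_range, nsmul_one, ← Finset.sum_div,
    ← Finset.mul_sum] at h1
  have h0 : 0 ≤ ∑ i ∈ Finset.range E.1, (b i - a i) :=
    Finset.sum_nonneg fun i _ => sub_nonneg.2 (hab i)
  refine h1.trans ?_
  gcongr
  refine sum_measureReal_le (fun i hi j hj hij => ?_) (fun _ _ => measurableSet_rect _ _ _ _)
    (fun i hi => rect_subset (Ioo_subset_Ioo ?_ ?_) le_rfl) (measure_rect_ne_top _ _ _ _)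
  · exact disjoint_rect ((hE.2 hi hj hij).mono Ioo_subset_Ioc_self Ioo_subset_Ioc_self) _
  · have := hE.1 i hi
    rw [uIcc_of_le zero_le_one] at this
    exact le_min this.1.1 this.2.1
  · have := hE.1 i hi
    rw [uIcc_of_le zero_le_one] at this
    exact max_le this.1.2 this.2.2

/-- Absolute continuity on a line along which the area density is finite. -/
theorem SquareBound.absolutelyContinuousOnInterval (hk : SquareBound k μ C) (hC : 0 ≤ C) {y M : ℝ}
    (hM : ∀ᶠ η in 𝓝[>] (0 : ℝ), μ.real (Ioo 0 1 ×ℂ Ioo y (y + η)) ≤ M * η) :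
    AbsolutelyContinuousOnInterval (fun x => k ⟨x, y⟩) 0 1 := by
  rw [absolutelyContinuousOnInterval_iff]
  intro ε hε
  have hδ : 0 < ε ^ 2 / (C * |M| + 1) := by positivity
  refine ⟨_, hδ, fun E hE hl => ?_⟩
  set l := ∑ i ∈ Finset.range E.1, dist (E.2 i).1 (E.2 i).2
  set S := ∑ i ∈ Finset.range E.1, dist (k ⟨(E.2 i).1, y⟩) (k ⟨(E.2 i).2, y⟩)
  have hl0 : 0 ≤ l := Finset.sum_nonneg fun _ _ => dist_nonneg
  -- The linear strip bound cancels the factor `1 / η`. The rounding term `E.1 * η`, which depends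
  -- on the number of intervals, vanishes as `η → 0` and leaves `S ^ 2 ≤ l * (C * |M|)`.
  have h1 : ∀ᶠ η in 𝓝[>] (0 : ℝ), S ^ 2 ≤ (l + E.1 * η) * (C * |M|) := by
    filter_upwards [hM, self_mem_nhdsWithin] with η h1 h2
    have hη : 0 < η := h2
    refine (hk.sq_sum_dist_le hC hη hE).trans ?_
    have h3 : μ.real (Ioo 0 1 ×ℂ Ioo y (y + η)) ≤ |M| * η :=
      h1.trans (mul_le_mul_of_nonneg_right (le_abs_self M) hη.le)
    calc (l / η + E.1) * (C * μ.real (Ioo 0 1 ×ℂ Ioo y (y + η)))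
        ≤ (l / η + E.1) * (C * (|M| * η)) := by gcongr
      _ = _ := by field_simp
  have h2 : Tendsto (fun η : ℝ => (l + E.1 * η) * (C * |M|)) (𝓝[>] 0)
      (𝓝 ((l + E.1 * 0) * (C * |M|))) :=
    ((by fun_prop : Continuous fun η : ℝ => (l + E.1 * η) * (C * |M|)).tendsto 0).mono_left
      nhdsWithin_le_nhds
  have h3 := ge_of_tendsto h2 h1
  rw [mul_zero, add_zero] at h3
  rw [lt_div_iff₀ (by positivity)] at hl
  refine lt_of_pow_lt_pow_left₀ 2 hε.le (h3.trans_lt ?_)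
  nlinarith

/-- On almost every horizontal line the area density is finite. -/
theorem ae_eventually_strip_le (μ : Measure ℂ) [IsFiniteMeasureOnCompacts μ] :
    ∀ᵐ y : ℝ, 0 < y → ∃ M : ℝ, ∀ᶠ η in 𝓝[>] (0 : ℝ),
      μ.real (Ioo 0 1 ×ℂ Ioo y (y + η)) ≤ M * η := by
  -- A monotone function is differentiable almost everywhere, and increments of `A` dominate the
  -- masses of thin strips.
  set A : ℝ → ℝ := fun y => μ.real (Ioo 0 1 ×ℂ Ioo 0 y)
  have hA : Monotone A := fun y y' h =>
    measureReal_mono (rect_subset le_rfl (Ioo_subset_Ioo le_rfl h)) (measure_rect_ne_top _ _ _ _)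
  filter_upwards [hA.ae_differentiableAt] with y hy hy0
  refine ⟨|deriv A y| + 1, ?_⟩
  have h1 := hy.hasDerivAt.tendsto_slope_zero_right
  have h2 : deriv A y < |deriv A y| + 1 := (le_abs_self _).trans_lt (lt_add_one _)
  filter_upwards [h1.eventually_lt_const h2, self_mem_nhdsWithin] with η h3 h4
  have hη : 0 < η := h4
  have h5 : A (y + η) - A y ≤ (|deriv A y| + 1) * η := by
    rw [smul_eq_mul, inv_mul_lt_iff₀ hη] at h3
    linarith
  refine le_trans ?_ h5
  rw [le_sub_iff_add_le, ← measureReal_union _ (measurableSet_rect _ _ _ _)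
    (measure_rect_ne_top _ _ _ _) (measure_rect_ne_top _ _ _ _)]
  · refine measureReal_mono (union_subset ?_ ?_) (measure_rect_ne_top _ _ _ _)
    · exact rect_subset le_rfl (Ioo_subset_Ioo hy0.le le_rfl)
    · exact rect_subset le_rfl (Ioo_subset_Ioo le_rfl (by linarith))
  · exact disjoint_left.2 fun z hz hz' => (hz.2.1.trans hz'.2.2).false

end Strip

/-! ### Nonvanishing derivatives of quasisymmetric maps. -/

/-- The quasisymmetry inequality with constant `C`. -/
def IsQuasisymmetric (k : ℂ → ℂ) (C : ℝ) : Prop :=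
  ∀ z u u' : ℂ, ‖u‖ ≤ 2 * ‖u'‖ → ‖k (z + u) - k z‖ ≤ C * ‖k (z + u') - k z‖

/-- A point whose preimage lies outside the ball of radius `r` has image at distance at least `‖k p
- k c‖ / C` from `k c`, since `‖p - c‖` is at most twice the preimage's distance from `c`. -/
theorem ball_subset_image_ball {k : ℂ ≃ₜ ℂ} {C : ℝ} (hC : 0 < C) (hk : IsQuasisymmetric k C)
    {c p : ℂ} {r : ℝ} (hp : ‖p - c‖ ≤ 2 * r) :
    Metric.ball (k c) (‖k p - k c‖ / C) ⊆ k '' Metric.ball c r := by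
  intro q hq
  refine ⟨k.symm q, ?_, k.apply_symm_apply q⟩
  by_contra h
  rw [Metric.mem_ball, not_lt, dist_eq_norm] at h
  have := hk c (p - c) (k.symm q - c) (by linarith)
  rw [add_sub_cancel, add_sub_cancel, k.apply_symm_apply, ← div_le_iff₀' hC] at this
  rw [Metric.mem_ball, dist_eq_norm] at hq
  linarith

/-- The image of a square contains a disc about the image of its centre, of radius comparable to the
distance to the image of either lower corner. The factor `4` comes from `(s + t) ^ 2 ≤ 2 * (s ^ 2 +
t ^ 2)` applied to two corners. -/
theorem squareBound_of_isQuasisymmetric {k : ℂ ≃ₜ ℂ} {C : ℝ} (hC : 0 < C)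
    (hk : IsQuasisymmetric k C) [IsFiniteMeasureOnCompacts (Measure.map k.symm volume)] :
    SquareBound k (Measure.map k.symm volume) (4 * C ^ 2) := by
  intro x y δ hδ
  set c : ℂ := ⟨x + δ / 2, y + δ / 2⟩
  have hr : ∀ p : ℂ, (p.re - (x + δ / 2)) ^ 2 = (δ / 2) ^ 2 → p.im = y →
      ‖p - c‖ ≤ 2 * (δ / 2) := fun p h1 h2 => by
    rw [← abs_of_nonneg (norm_nonneg (p - c))]
    refine abs_le_of_sq_le_sq ?_ (by positivity)
    rw [HypThree.norm_sq_eq, Complex.sub_re, Complex.sub_im, h1, h2]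
    simp only [c]
    nlinarith
  have hball : Metric.ball c (δ / 2) ⊆ Ioo x (x + δ) ×ℂ Ioo y (y + δ) := by
    intro p hp
    rw [Metric.mem_ball, dist_eq_norm] at hp
    have h1 := (Complex.abs_re_le_norm (p - c)).trans_lt hp
    have h2 := (Complex.abs_im_le_norm (p - c)).trans_lt hp
    rw [Complex.sub_re, abs_lt] at h1
    rw [Complex.sub_im, abs_lt] at h2
    simp only [c] at h1 h2
    exact ⟨⟨by linarith, by linarith⟩, ⟨by linarith, by linarith⟩⟩
  have key : ∀ p : ℂ, ‖p - c‖ ≤ 2 * (δ / 2) → (‖k p - k c‖ / C) ^ 2 ≤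
      (Measure.map k.symm volume).real (Ioo x (x + δ) ×ℂ Ioo y (y + δ)) := fun p hp => by
    have h1 : Metric.ball (k c) (‖k p - k c‖ / C) ⊆
        k.symm ⁻¹' (Ioo x (x + δ) ×ℂ Ioo y (y + δ)) := by
      rw [← k.image_eq_preimage_symm]
      exact (ball_subset_image_ball hC hk hp).trans (image_mono hball)
    have h2 : (Measure.map k.symm volume) (Ioo x (x + δ) ×ℂ Ioo y (y + δ)) =
        volume (k.symm ⁻¹' (Ioo x (x + δ) ×ℂ Ioo y (y + δ))) :=
      Measure.map_apply k.symm.continuous.measurable (measurableSet_rect _ _ _ _)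
    have h3 : volume (k.symm ⁻¹' (Ioo x (x + δ) ×ℂ Ioo y (y + δ))) ≠ ⊤ := by
      rw [← h2]
      exact measure_rect_ne_top _ _ _ _
    rw [measureReal_def, h2, ← ENNReal.ofReal_le_iff_le_toReal h3]
    refine le_trans ?_ (measure_mono h1)
    rw [Complex.volume_ball, ENNReal.ofReal_pow (by positivity)]
    refine le_mul_of_one_le_right' ?_
    exact_mod_cast (by linarith [Real.pi_gt_three] : (1 : ℝ) ≤ Real.pi)
  have k1 := key ⟨x, y⟩ (hr _ (by simp) rfl)
  have k2 := key ⟨x + δ, y⟩ (hr _ (by simp; ring) rfl)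
  have h4 : dist (k ⟨x, y⟩) (k ⟨x + δ, y⟩) ≤ ‖k ⟨x, y⟩ - k c‖ + ‖k ⟨x + δ, y⟩ - k c‖ := by
    rw [← dist_eq_norm, ← dist_eq_norm]
    exact dist_triangle_right _ _ _
  rw [div_pow, div_le_iff₀ (by positivity)] at k1 k2
  nlinarith [pow_le_pow_left₀ dist_nonneg h4 2,
    sq_nonneg (‖k ⟨x, y⟩ - k c‖ - ‖k ⟨x + δ, y⟩ - k c‖)]

/-- A quasisymmetric homeomorphism has a nonzero horizontal derivative on a set of positive
measure. -/
theorem volume_nonzero_horizontal_deriv_ne_zero {k : ℂ ≃ₜ ℂ} {C : ℝ} (hC : 0 < C)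
    (hk : IsQuasisymmetric k C) :
    volume {z : ℂ | ∃ w : ℂ, w ≠ 0 ∧ HasDerivAt (fun s : ℝ => k (z + s)) w 0} ≠ 0 := by
  intro h0
  have : IsFiniteMeasureOnCompacts (Measure.map k.symm volume) := ⟨fun K hK => by
    rw [Measure.map_apply k.symm.continuous.measurable hK.measurableSet,
      ← k.image_eq_preimage_symm]
    exact (hK.image k.continuous).measure_lt_top⟩
  have hsq := squareBound_of_isQuasisymmetric hC hk
  have h1 : ∀ᵐ z : ℂ, ¬ ∃ w : ℂ, w ≠ 0 ∧ HasDerivAt (fun s : ℝ => k (z + s)) w 0 := by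
    rw [ae_iff]
    simpa using h0
  -- The coordinates are swapped so that Fubini gives almost every height first.
  have h2 : ∀ᵐ p : ℝ × ℝ, ¬ ∃ w : ℂ, w ≠ 0 ∧
      HasDerivAt (fun s : ℝ => k ((⟨p.2, p.1⟩ : ℂ) + s)) w 0 :=
    (Complex.volume_preserving_equiv_real_prod.symm.comp
      Measure.measurePreserving_swap).quasiMeasurePreserving.ae h1
  have h3 := Measure.ae_ae_of_ae_prod h2
  have h4 : ∃ y : ℝ, y ∈ Ioi (0 : ℝ) ∧ (∀ᵐ x : ℝ, ¬ ∃ w : ℂ, w ≠ 0 ∧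
      HasDerivAt (fun s : ℝ => k ((⟨x, y⟩ : ℂ) + s)) w 0) ∧
      ∃ M : ℝ, ∀ᶠ η in 𝓝[>] (0 : ℝ),
        (Measure.map k.symm volume).real (Ioo 0 1 ×ℂ Ioo y (y + η)) ≤ M * η := by
    have h5 := (h3.and (ae_eventually_strip_le (Measure.map k.symm volume)))
    have h6 : ∃ᶠ y in ae (volume : Measure ℝ), y ∈ Ioi (0 : ℝ) := by
      rw [frequently_ae_mem_iff]
      simp
    obtain ⟨y, hy, hy1, hy2⟩ := (h6.and_eventually h5).exists
    exact ⟨y, hy, hy1, hy2 hy⟩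
  obtain ⟨y, -, hy, M, hM⟩ := h4
  have hac := hsq.absolutelyContinuousOnInterval (by positivity) hM
  have hdiff := hac.boundedVariationOn.ae_differentiableAt_of_mem_uIcc
  -- On this line the derivative exists almost everywhere on the unit interval and is never nonzero
  -- outside a null set, so absolute continuity forces the function to be constant.
  obtain ⟨c, hc⟩ := hac.const_of_ae_hasDerivAt_zero (by
    filter_upwards [hy, hdiff] with x hx1 hx2 hx3
    have h5 := (hx2 hx3).hasDerivAt
    by_cases hw : deriv (fun x : ℝ => k ⟨x, y⟩) x = 0
    · rwa [hw] at h5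
    · refine absurd ⟨_, hw, ?_⟩ hx1
      have h6 : HasDerivAt (fun s : ℝ => k ⟨x + s, y⟩)
          (deriv (fun x : ℝ => k ⟨x, y⟩) x) 0 := by
        have h7 : HasDerivAt (fun x : ℝ => k ⟨x, y⟩) (deriv (fun x : ℝ => k ⟨x, y⟩) x)
          (x + 0) := by rwa [add_zero]
        exact h7.comp_const_add x 0
      refine h6.congr_of_eventuallyEq (Eventually.of_forall fun s => ?_)
      refine congrArg k (Complex.ext ?_ ?_) <;> simp)
  have h7 := (hc 0 (by simp)).trans (hc 1 (by simp)).symm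
  simpa using congrArg Complex.re (k.injective h7)

/-! ### Density points of the horizontal derivative. -/

/-- At almost every point of the set where the horizontal derivative exists and does not vanish,
small-scale difference quotients at nearby points are uniformly close to it. -/
theorem exists_density_point {k : ℂ → ℂ}
    (h0 : volume {z : ℂ | ∃ w : ℂ, w ≠ 0 ∧ HasDerivAt (fun s : ℝ => k (z + s)) w 0} ≠ 0) :
    ∃ z w : ℂ, w ≠ 0 ∧ HasDerivAt (fun s : ℝ => k (z + s)) w 0 ∧ ∀ ε : ℝ, 0 < ε → ∀ u : ℂ,
      ∃ v : ℕ → ℂ, Tendsto v atTop (𝓝 u) ∧ ∀ s : ℝ, ∀ᶠ n : ℕ in atTop,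
        ‖((n : ℝ) + 1) • (k (z + (1 / ((n : ℝ) + 1)) • (v n + s)) -
          k (z + (1 / ((n : ℝ) + 1)) • v n)) - s • w‖ ≤ ε * |s| := by
  -- Countably many sets suffice: accuracy `1 / (m + 1)`, scale `1 / (l + 1)`, and a dense sequence
  -- in place of the unknown derivative. Besicovitch's density theorem then applies to all of them
  -- at once, with no measurability to check.
  set S : ℕ → ℕ → ℕ → Set ℂ := fun m l j => {z | ∀ s : ℝ, |s| < 1 / ((l : ℝ) + 1) →
    ‖k (z + s) - k z - s • TopologicalSpace.denseSeq ℂ j‖ ≤ 1 / ((m : ℝ) + 1) * |s|}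
  have h1 : ∀ᵐ z : ℂ, ∀ m l j, z ∈ S m l j → Tendsto (fun r => volume (S m l j ∩
      Metric.closedBall z r) / volume (Metric.closedBall z r)) (𝓝[>] 0) (𝓝 1) := by
    simp only [ae_all_iff]
    exact fun m l j =>
      ae_imp_of_ae_restrict (Besicovitch.ae_tendsto_measure_inter_div volume (S m l j))
  obtain ⟨z, ⟨w, hw, hd⟩, hz⟩ := ((frequently_ae_mem_iff.2 h0).and_eventually h1).exists
  refine ⟨z, w, hw, hd, fun ε hε u => ?_⟩
  obtain ⟨m, hm⟩ := exists_nat_one_div_lt (half_pos hε)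
  have hm0 : (0 : ℝ) < 1 / ((m : ℝ) + 1) := by positivity
  -- Half of the accuracy `1 / (m + 1)` goes to replacing `w` by `q`, the other half to
  -- differentiability at `z`; this puts `z` in `S m l j`.
  obtain ⟨j, hj⟩ : ∃ j, dist w (TopologicalSpace.denseSeq ℂ j) < 1 / ((m : ℝ) + 1) / 2 :=
    (TopologicalSpace.denseRange_denseSeq ℂ).exists_dist_lt w (half_pos hm0)
  set q := TopologicalSpace.denseSeq ℂ j
  obtain ⟨l, hl⟩ : ∃ l, z ∈ S m l j := by
    have h2 := (hasDerivAt_iff_isLittleO_nhds_zero.1 hd).def (half_pos hm0)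
    rw [Metric.eventually_nhds_iff] at h2
    obtain ⟨δ, hδ, h3⟩ := h2
    obtain ⟨l, hl⟩ := exists_nat_one_div_lt hδ
    refine ⟨l, fun s hs => ?_⟩
    have h4 := h3 (y := s) (by rw [Real.dist_eq, sub_zero]; linarith)
    simp only [zero_add, Complex.ofReal_zero, add_zero] at h4
    have h5 : k (z + s) - k z - s • q = (k (z + s) - k z - s • w) + s • (w - q) := by
      rw [smul_sub]; ring
    rw [h5]
    refine (norm_add_le _ _).trans ?_
    rw [norm_smul, Real.norm_eq_abs, ← dist_eq_norm w q]
    rw [Real.norm_eq_abs] at h4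
    nlinarith [abs_nonneg s]
  have hdens := hz m l j hl
  set T : ℕ → Set ℂ := fun n => {v | z + (1 / ((n : ℝ) + 1)) • v ∈ S m l j}
  have hT0 : ∀ n, (T n).Nonempty := fun n => ⟨0, by simpa [T] using hl⟩
  -- Density one at `z` means that the rescaled sets `T n` eventually meet every ball, however
  -- small, around any `u`.
  have hinf : Tendsto (fun n => Metric.infDist u (T n)) atTop (𝓝 0) := by
    rw [tendsto_order]
    refine ⟨fun a ha => Eventually.of_forall fun n => ha.trans_le Metric.infDist_nonneg,
      fun a ha => ?_⟩
    have h2 := Measure.eventually_nonempty_inter_smul_of_density_one volume (S m l j) z hdens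
      (Metric.ball u a) measurableSet_ball (Metric.measure_ball_pos _ _ ha).ne'
    have h3 : Tendsto (fun n : ℕ => 1 / ((n : ℝ) + 1)) atTop (𝓝[>] 0) :=
      tendsto_nhdsWithin_iff.2 ⟨tendsto_one_div_add_atTop_nhds_zero_nat,
        Eventually.of_forall fun n => mem_Ioi.2 (one_div_pos.2 n.cast_add_one_pos)⟩
    filter_upwards [h3.eventually h2] with n hn
    obtain ⟨x, hx, hx'⟩ := hn
    rw [singleton_add, mem_image] at hx'
    obtain ⟨_, ⟨v, hv, rfl⟩, rfl⟩ := hx'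
    have hvT : v ∈ T n := hx
    exact (Metric.infDist_le_dist_of_mem hvT).trans_lt (by rw [dist_comm]; exact hv)
  have h2 : ∀ n : ℕ, ∃ v ∈ T n, dist u v < Metric.infDist u (T n) + 1 / ((n : ℝ) + 1) := fun n =>
    (Metric.infDist_lt_iff (hT0 n)).1 (lt_add_of_pos_right _ (one_div_pos.2 n.cast_add_one_pos))
  choose v hv hvu using h2
  refine ⟨v, ?_, fun s => ?_⟩
  · rw [tendsto_iff_dist_tendsto_zero]
    have h3 := hinf.add tendsto_one_div_add_atTop_nhds_zero_nat
    rw [add_zero] at h3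
    exact squeeze_zero (fun _ => dist_nonneg) (fun n => by rw [dist_comm]; exact (hvu n).le) h3
  · have h3 : Tendsto (fun n : ℕ => |s| * (1 / ((n : ℝ) + 1))) atTop (𝓝 (|s| * 0)) :=
      tendsto_one_div_add_atTop_nhds_zero_nat.const_mul _
    rw [mul_zero] at h3
    filter_upwards [h3.eventually_lt_const (show (0 : ℝ) < 1 / ((l : ℝ) + 1) by positivity)]
      with n hn
    have hn0 : (0 : ℝ) < (n : ℝ) + 1 := n.cast_add_one_pos
    have habs : |s / ((n : ℝ) + 1)| = |s| * (1 / ((n : ℝ) + 1)) := by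
      rw [abs_div, abs_of_pos hn0]; ring
    have h4 := hv n (s / ((n : ℝ) + 1)) (by rwa [habs])
    have e1 : z + (1 / ((n : ℝ) + 1)) • v n + ((s / ((n : ℝ) + 1) : ℝ) : ℂ) =
        z + (1 / ((n : ℝ) + 1)) • (v n + s) := by
      simp only [Complex.real_smul]
      push_cast
      ring
    rw [e1] at h4
    set D := k (z + (1 / ((n : ℝ) + 1)) • (v n + s)) - k (z + (1 / ((n : ℝ) + 1)) • v n)
    have e2 : ((n : ℝ) + 1) • D - s • w =
        ((n : ℝ) + 1) • (D - (s / ((n : ℝ) + 1)) • q) - s • (w - q) := by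
      rw [smul_sub ((n : ℝ) + 1) D, smul_smul, mul_div_cancel₀ _ hn0.ne', smul_sub s]
      ring
    rw [e2]
    refine (norm_sub_le _ _).trans ?_
    rw [norm_smul, norm_smul, Real.norm_of_nonneg hn0.le, Real.norm_eq_abs, ← dist_eq_norm w q]
    have h5 := mul_le_mul_of_nonneg_left h4 hn0.le
    rw [habs] at h5
    have e3 : ((n : ℝ) + 1) * (1 / ((m : ℝ) + 1) * (|s| * (1 / ((n : ℝ) + 1)))) =
        1 / ((m : ℝ) + 1) * |s| := by field_simp
    rw [e3] at h5
    nlinarith [abs_nonneg s]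

/-! ### Good directions in the limit. -/

theorem isGoodDirection_of_forall {h : ℂ → ℂ} {v w : ℂ} (hv : v ≠ 0) (hw : w ≠ 0)
    (hh : ∀ (p : ℂ) (s : ℝ), h (p + s * v) = h p + s * w) : IsGoodDirection h v := by
  intro p
  refine ⟨⟨h p, w, hw, ?_⟩, ‖w‖ / ‖v‖, div_pos (norm_pos_iff.2 hw) (norm_pos_iff.2 hv), ?_⟩
  · ext y
    constructor
    · rintro ⟨_, ⟨s, rfl⟩, rfl⟩
      exact ⟨s, hh p s⟩
    · rintro ⟨s, rfl⟩
      exact ⟨_, ⟨s, rfl⟩, hh p s⟩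
  · rintro _ ⟨s, rfl⟩ _ ⟨s', rfl⟩
    have := norm_ne_zero_iff.2 hv
    rw [hh, hh, dist_add_left, dist_add_left, dist_eq_norm, dist_eq_norm, ← sub_mul, ← sub_mul,
      norm_mul, norm_mul]
    field_simp

/-- Every equivariant pair zooms to an equivalent one for which the direction `v` is good. -/
theorem IsEquivariantPair.exists_zoomsTo_isGoodDirection {H : Equiv.Perm HypThree} {h : ℂ ≃ₜ ℂ}
    (hH : IsEquivariantPair H h.onePointCongr) {v : ℂ} (hv : v ≠ 0) :
    ∃ (H' : Equiv.Perm HypThree) (h' : ℂ ≃ₜ ℂ), ZoomsTo H h H' h' ∧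
      IsEquivariantPair H' h'.onePointCongr ∧
      PairEquivalent H h.onePointCongr H' h'.onePointCongr ∧ IsGoodDirection h' v := by
  obtain ⟨C, hC, hqs⟩ := hH.quasisymmetric
  -- Precomposition with multiplication by `v` turns the direction of `v` into the horizontal one.
  let k : ℂ ≃ₜ ℂ := (Homeomorph.mulLeft₀ v hv).trans h
  have hk : ∀ z, k z = h (v * z) := fun z => rfl
  have hkqs : IsQuasisymmetric k C := fun z u u' hu => by
    simp only [hk, mul_add]
    refine hqs _ _ _ ?_
    rw [norm_mul, norm_mul]
    nlinarith [norm_nonneg v]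
  obtain ⟨z, w, hw, hd, happrox⟩ :=
    exists_density_point (volume_nonzero_horizontal_deriv_ne_zero hC hkqs)
  have hzoom : ∀ (n : ℕ) (u : ℂ), zoomPlane h (v * z) n (v * z + v * u) =
      ((n : ℝ) + 1) • (k (z + (1 / ((n : ℝ) + 1)) • u) - k z) + h (v * z) := fun n u => by
    rw [zoomPlane_eq, hk, hk, add_sub_cancel_left, mul_add, mul_smul_comm]
  have hlim : Tendsto (fun n : ℕ => zoomPlane h (v * z) n (v * z + v)) atTop
      (𝓝 (h (v * z) + w)) := by
    have h1 := hd.tendsto_slope_zero_right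
    have h2 : Tendsto (fun n : ℕ => 1 / ((n : ℝ) + 1)) atTop (𝓝[>] 0) :=
      tendsto_nhdsWithin_iff.2 ⟨tendsto_one_div_add_atTop_nhds_zero_nat,
        Eventually.of_forall fun n => mem_Ioi.2 (one_div_pos.2 n.cast_add_one_pos)⟩
    have h3 := (h1.comp h2).add_const (h (v * z))
    rw [add_comm w] at h3
    refine h3.congr fun n => ?_
    have h4 := hzoom n 1
    rw [mul_one] at h4
    rw [h4]
    simp [Complex.real_smul]
  obtain ⟨H', h', s, hs, hZ, hE, hP, hconv⟩ := hH.exists_zoomsTo hv hw hlim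
  refine ⟨H', h', hZ, hE, hP, isGoodDirection_of_forall hv hw fun p x => ?_⟩
  rw [← sub_eq_zero, ← norm_le_zero_iff]
  refine le_of_forall_pos_le_add fun ε hε => ?_
  rw [zero_add]
  -- The points `v * z + v * u n` tend to `p`, and the difference quotients there are within a
  -- prescribed error of `w`. Continuous convergence lets the base point vary with `n`, so the limit
  -- satisfies the estimate at `p` itself.
  obtain ⟨u, hu, hux⟩ := happrox (ε / (|x| + 1)) (by positivity) ((p - v * z) / v)
  have hu' : Tendsto (fun n => v * z + v * u (s n)) atTop (𝓝 p) := by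
    have h1 := ((hu.comp hs.tendsto_atTop).const_mul v).const_add (v * z)
    rwa [mul_div_cancel₀ _ hv, add_sub_cancel] at h1
  have hux' : Tendsto (fun n => v * z + v * (u (s n) + x)) atTop (𝓝 (p + x * v)) := by
    refine (hu'.add_const (x * v)).congr fun n => ?_
    ring
  have h2 := ((hconv.tendsto_apply hux').sub ((hconv.tendsto_apply hu').add_const (x * w))).norm
  refine le_of_tendsto h2 ?_
  filter_upwards [hs.tendsto_atTop.eventually (hux x)] with n hn
  rw [hzoom, hzoom]
  have e : ∀ a b c d e : ℂ, ∀ r : ℝ, r • (a - b) + c - (r • (d - b) + c + e) = r • (a - d) - e := by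
    intro a b c d e r
    simp only [Complex.real_smul]
    ring
  rw [e]
  rw [Complex.real_smul (x := x)] at hn
  refine hn.trans ?_
  rw [div_mul_eq_mul_div, div_le_iff₀ (by positivity)]
  nlinarith

/-- The goodness gained from the first zoom is discarded; the second zoom produces it afresh for
`h''`. -/
theorem corollary7 (H : Equiv.Perm HypThree) (h : ℂ ≃ₜ ℂ)
    (hH : IsEquivariantPair H h.onePointCongr) (v : ℂ) (hv : v ≠ 0) :
    ∃ (H' H'' : Equiv.Perm HypThree) (h' h'' : ℂ ≃ₜ ℂ),
      ZoomsTo H h H' h' ∧ ZoomsTo H' h' H'' h'' ∧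
      IsEquivariantPair H' h'.onePointCongr ∧
      PairEquivalent H h.onePointCongr H' h'.onePointCongr ∧
      IsEquivariantPair H'' h''.onePointCongr ∧
      PairEquivalent H h.onePointCongr H'' h''.onePointCongr ∧
      IsGoodDirection h'' v := by
  obtain ⟨H', h', hZ, hE, hP, -⟩ := hH.exists_zoomsTo_isGoodDirection hv
  obtain ⟨H'', h'', hZ', hE', hP', hG⟩ := hE.exists_zoomsTo_isGoodDirection hv
  exact ⟨H', H'', h', h'', hZ, hZ', hE, hP, hE', hP.trans hP', hG⟩
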